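/- **Notation.** Let $|\cdot|$ be the Euclidean norm on $\mathbb{R}^d$, $d\ge 1$, and $\mathbb{R}_+=[0,\infty)$. "Distribution" means probability measure. For functions $f,g$ of $r$ that are positive for large $r$, $f(r)\asymp g(r)$ means $0<\liminf_{r\to\infty}f(r)/g(r)\le\limsup_{r\to\infty}f(r)/g(r)<\infty$. A distribution $\zeta$ on $\mathbb{R}_+$ is O-subexponential ($\zeta\in\mathcal{OS}$ on $\mathbb{R}_+$) if $\zeta(x>r)>0$ for all $r$ and $\zeta*\zeta(x>r)\asymp\zeta(x>r)$. A distribution $\rho$ on $\mathbb{R}^d$ is O-subexponential ($\rho\in\mathcal{OS}$ on $\mathbb{R}^d$) if the law $\zeta_\rho$ of $|x|$ under $\rho$, i.e. $\zeta_\rho(x>r)=\rho(|x|>r)$ for $r\ge0$, belongs to $\mathcal{OS}$ on $\mathbb{R}_+$. $\mu^{n*}$ is the $n$-th convolution power of $\mu$. "Increasing" is meant in the wide sense (non-decreasing). **Theorem 3.1.** Let $\rho$ be an infinitely divisible distribution on $\mathbb{R}^d$ with Lévy measure $\eta$; that is, $\eta(\{0\})=0$, $\int(1\wedge|x|^2)\,\eta(dx)<\infty$,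 and for some nonnegative-definite symmetric matrix $A$ and some $\gamma\in\mathbb{R}^d$, $$\int e^{i\langle z,x\rangle}\rho(dx)=\exp\Big(\int\big(e^{i\langle z,x\rangle}-1-1_{\{|x|\le1\}}i\langle z,x\rangle\big)\eta(dx)+i\langle\gamma,z\rangle-\tfrac12\langle Az,z\rangle\Big),\qquad z\in\mathbb{R}^d.$$ Suppose that $\eta(|x|>1)>0$, and define the distribution $\widetilde\eta(dx):=\eta(|x|>1)^{-1}1_{\{|x|>1\}}\eta(dx)$ on $\mathbb{R}^d$ and the distribution $\zeta$ on $\mathbb{R}_+$ by $\zeta(x>r):=\widetilde\eta(|x|>r)$, $r\ge0$. (i) $\rho\in\mathcal{OS}$ on $\mathbb{R}^d$ if and only if there is a positive integer $n$ such that $\widetilde\eta^{n*}\in\mathcal{OS}$ on $\mathbb{R}^d$. Moreover, if $\rho\in\mathcal{OS}$, then $\rho(|x|>r)\asymp\widetilde\eta^{n*}(|x|>r)$ for every positive integer $n$ with $\widetilde\eta^{n*}\in\mathcal{OS}$. (ii) If $\widetilde\eta\in\mathcal{OS}$, then $\rho(|x|>r)\asymp\eta(|x|>r)$. (iii) $\rho\in\mathcal{OS}$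 if and only if there is a positive integer $m$ such that $\zeta^{m*}\in\mathcal{OS}$ on $\mathbb{R}_+$ and $\rho(|x|>r)\asymp\zeta^{m*}(x>r)$. (iv) Let $h$ be a nonnegative increasing function on $\mathbb{R}_+$, and suppose that $\widetilde\eta\in\mathcal{OS}$. Then $\int_{\mathbb{R}^d}h(|x|)\,\rho(dx)<\infty$ if and only if $\int_{|x|>1}h(|x|)\,\eta(dx)<\infty$. -/

import Mathlib

open MeasureTheory Filter
open scoped ENNReal NNReal Matrix

noncomputable section

/-- The relation `f ≍ g`: `0 < liminf f / g ≤ limsup f / g < ∞` as `r → ∞`, for functions which are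
positive and finite for large `r`. With the conventions of `ℝ≥0∞` (`0 / 0 = 0`, `a / 0 = ∞` for
`a ≠ 0`, `a / ∞ = 0`) the two inequalities below force `f` and `g` to be eventually positive, and
`f` and `g` to be eventually finite. -/
def AsympEquiv (f g : ℝ → ℝ≥0∞) : Prop :=
  0 < liminf (fun r => f r / g r) atTop ∧ limsup (fun r => f r / g r) atTop < ∞

/-- The radial tail `r ↦ η(|x| > r)` of a measure on `ℝ^d`. -/
def normTail {d : ℕ} (η : Measure (EuclideanSpace ℝ (Fin d))) (r : ℝ) : ℝ≥0∞ :=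
  η {x | r < ‖x‖}

/-- The right tail `r ↦ ζ(x > r)` of a measure on `ℝ₊ = [0, ∞)`. -/
def rightTail (ζ : Measure ℝ≥0) (r : ℝ) : ℝ≥0∞ :=
  ζ {x | r < (x : ℝ)}

/-- The convolution power `μ^{n*}` (the Dirac mass at `0` for `n = 0`). -/
def convPower {M : Type*} [AddMonoid M] [MeasurableSpace M] (μ : Measure M) : ℕ → Measure M
  | 0 => Measure.dirac 0
  | n + 1 => (convPower μ n).conv μ

/-- The law `ζ` on `ℝ₊` of the norm under `ρ`, i.e. `ζ(x > r) = ρ(|x| > r)`. -/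
def radialLaw {d : ℕ} (ρ : Measure (EuclideanSpace ℝ (Fin d))) : Measure ℝ≥0 :=
  ρ.map (fun x => ‖x‖₊)

theorem rightTail_radialLaw {d : ℕ} (ρ : Measure (EuclideanSpace ℝ (Fin d))) (r : ℝ) :
    rightTail (radialLaw ρ) r = normTail ρ r := by
  have h : MeasurableSet {x : ℝ≥0 | r < (x : ℝ)} :=
    measurableSet_lt measurable_const NNReal.continuous_coe.measurable
  simp only [rightTail, radialLaw, normTail]
  rw [Measure.map_apply measurable_nnnorm h]
  rfl

/-- The class `OS` of O-subexponential distributions on `ℝ₊`: `ζ * ζ(x > r) ≍ ζ(x > r)`. -/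
def IsOSubexpHalfLine (ζ : Measure ℝ≥0) : Prop :=
  AsympEquiv (rightTail (ζ.conv ζ)) (rightTail ζ)

/-- The class `OS` on `ℝ^d`: the law of the norm is in the class `OS` on `ℝ₊`. -/
def IsOSubexp {d : ℕ} (ρ : Measure (EuclideanSpace ℝ (Fin d))) : Prop :=
  IsOSubexpHalfLine (radialLaw ρ)

/-- A distribution is infinitely divisible if it has an `n`-th convolution root for all `n ≥ 1`. -/
def IsInfinitelyDivisible {d : ℕ} (ρ : Measure (EuclideanSpace ℝ (Fin d))) : Prop :=
  ∀ n : ℕ, 0 < n → ∃ ν : Measure (EuclideanSpace ℝ (Fin d)),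
    IsProbabilityMeasure ν ∧ convPower ν n = ρ

/-- The exponent `∫ (e^{i⟨z,x⟩} - 1 - 1_{|x| ≤ 1} i⟨z,x⟩) ν(dx) + i⟨γ,z⟩ - ⟨Az,z⟩ / 2`. -/
def levyExponent {d : ℕ} (A : Matrix (Fin d) (Fin d) ℝ) (ν : Measure (EuclideanSpace ℝ (Fin d)))
    (γ z : EuclideanSpace ℝ (Fin d)) : ℂ :=
  (∫ x, (Complex.exp (Complex.I * (inner ℝ z x : ℝ)) - 1
      - (if ‖x‖ ≤ 1 then Complex.I * (inner ℝ z x : ℝ) else 0)) ∂ν)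
    + Complex.I * (inner ℝ γ z : ℝ)
    - (1 / 2 : ℂ) * (((A *ᵥ z.ofLp) ⬝ᵥ z.ofLp : ℝ) : ℂ)

/-- `η` is the Lévy measure in a generating triplet `(A, η, γ)` of `ρ`. -/
def IsLevyMeasureOf {d : ℕ} (η ρ : Measure (EuclideanSpace ℝ (Fin d))) : Prop :=
  η {0} = 0 ∧
  (∫⁻ x, ENNReal.ofReal (min 1 (‖x‖ ^ 2)) ∂η) < ∞ ∧
  ∃ (A : Matrix (Fin d) (Fin d) ℝ) (γ : EuclideanSpace ℝ (Fin d)), A.PosSemidef ∧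
    ∀ z, charFun ρ z = Complex.exp (levyExponent A η γ z)

/-- The normalized tail measure `η̃ = η(|x| > 1)⁻¹ 1_{|x| > 1} η`, meaningful (and then a
probability measure) when `0 < η(|x| > 1) < ∞`. -/
def normalizedTail {d : ℕ} (η : Measure (EuclideanSpace ℝ (Fin d))) :
    Measure (EuclideanSpace ℝ (Fin d)) :=
  (η {x | 1 < ‖x‖})⁻¹ • η.restrict {x | 1 < ‖x‖}

end

/-! For tails of probability measures, `≍` amounts to two-sided domination by constants on the whole
line, a relation preserved by convolution on the half-line. Membership in OS then says that one
self-convolution costs a constant factor `C`. Two consequences drive the proof: Kesten's bound `C ^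
n` for `n`-fold powers, and at most exponential decay, in that a shift by `u` costs a factor `K
e^{bu}`.

By Lévy–Khintchine, `ρ` is the convolution of a measure `ν` (Gaussian, drift and compensated small
jumps) with the compound Poisson law of `c • η̃` (`IsLevyMeasureOf.exists_conv_compoundPoisson`).
All exponential moments of `ν` are finite, so `ν` neither creates nor hides a tail in OS
(`IsOSubexp.tailLE_conv_right`, `IsOSubexp.tailLE_of_conv`). It remains to compare the compound
Poisson law with powers of `η̃`.

If `η̃^{n*}` is in OS, geometric bounds on the tails of all powers are summed against Poisson
weights, while a single term of the series gives the reverse bound.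

Conversely, let the compound Poisson law be in OS. Its self-convolution doubles the intensity, so
inserting weights `2 ^ k` in the series of tails costs only a constant. Hence finitely many terms `k
< N` carry half of the sum, and each is dominated, after a bounded shift, by the `N`-th power
(`IsOSubexp.exists_tailLE_convPower`).

For (iii), powers of the radial law dominate the radial tails of powers and obey the same Kesten
bound. For (iv), superlevel sets of an increasing function of the norm are radial tails, open or
closed. -/

/-! ### Domination of tails and the relation `≍`. -/

/-- `f` is dominated by a constant multiple of `g` on the whole line. -/
def TailLE (f g : ℝ → ℝ≥0∞) : Prop := ∃ K : ℝ≥0, ∀ r, f r ≤ K * g r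

theorem TailLE.trans {f g h : ℝ → ℝ≥0∞} (hfg : TailLE f g) (hgh : TailLE g h) : TailLE f h := by
  obtain ⟨K, hK⟩ := hfg
  obtain ⟨L, hL⟩ := hgh
  refine ⟨K * L, fun r => (hK r).trans ?_⟩
  rw [ENNReal.coe_mul, mul_assoc]
  gcongr
  exact hL r

theorem TailLE.of_le {f g : ℝ → ℝ≥0∞} (h : ∀ r, f r ≤ g r) : TailLE f g :=
  ⟨1, fun r => by simpa using h r⟩

theorem TailLE.pos {f g : ℝ → ℝ≥0∞} (h : TailLE f g) (hf : ∀ r, 0 < f r) (r : ℝ) : 0 < g r := by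
  obtain ⟨K, hK⟩ := h
  by_contra! h0
  have := hK r
  rw [nonpos_iff_eq_zero.1 h0, mul_zero] at this
  exact absurd (hf r) (not_lt.2 this)

/-- An eventual bound between antitone functions extends to the whole line. -/
theorem TailLE.of_eventually {f g : ℝ → ℝ≥0∞} (hf : ∀ r, f r ≤ 1) (hg1 : ∀ r, g r ≤ 1)
    (hg : Antitone g) (hpos : ∀ r, 0 < g r) {K : ℝ≥0∞} (hK : K ≠ ∞)
    (h : ∀ᶠ r in atTop, f r ≤ K * g r) : TailLE f g := by
  obtain ⟨R, hR⟩ := eventually_atTop.1 h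
  -- The summand `(g R)⁻¹` serves `r ≤ R`, where `f r ≤ 1 = (g R)⁻¹ * g R` and `g R ≤ g r`.
  have h1 : K + (g R)⁻¹ ≠ ∞ := by
    simp [hK, (hpos R).ne']
  refine ⟨(K + (g R)⁻¹).toNNReal, fun r => ?_⟩
  rw [ENNReal.coe_toNNReal h1]
  rcases le_total R r with hr | hr
  · exact (hR r hr).trans (by gcongr; exact le_self_add)
  · have hgR : g R ≠ ∞ := ((hg1 R).trans_lt ENNReal.one_lt_top).ne
    calc f r ≤ 1 := hf r
      _ = (g R)⁻¹ * g R := (ENNReal.inv_mul_cancel (hpos R).ne' hgR).symm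
      _ ≤ (K + (g R)⁻¹) * g r := by
        gcongr
        · exact le_add_self
        · exact hg hr

theorem asympEquiv_of_eventually {f g : ℝ → ℝ≥0∞} {K L : ℝ≥0∞} (hK : K ≠ ∞) (hL : L ≠ ∞)
    (hpos : ∀ᶠ r in atTop, 0 < g r) (hfin : ∀ᶠ r in atTop, g r ≠ ∞)
    (hfg : ∀ᶠ r in atTop, f r ≤ K * g r) (hgf : ∀ᶠ r in atTop, g r ≤ L * f r) :
    AsympEquiv f g := by
  constructor
  · refine lt_of_lt_of_le (ENNReal.inv_pos.2 hL) (le_liminf_of_le (by isBoundedDefault) ?_)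
    filter_upwards [hpos, hfin, hgf] with r h0 h1 h2
    rw [ENNReal.le_div_iff_mul_le (Or.inl h0.ne') (Or.inl h1), mul_comm, ← div_eq_mul_inv]
    exact ENNReal.div_le_of_le_mul' h2
  · refine lt_of_le_of_lt (limsup_le_of_le (by isBoundedDefault) ?_) hK.lt_top
    filter_upwards [hfg] with r h2
    exact ENNReal.div_le_of_le_mul h2

/-- Positivity comes from the conventions for division: `0 / g` is below every positive lower bound,
and `f / 0 = ∞` for `f ≠ 0` exceeds every finite upper bound. -/
theorem AsympEquiv.eventually {f g : ℝ → ℝ≥0∞} (hg : ∀ r, g r ≤ 1)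
    (h : AsympEquiv f g) : ∃ K L : ℝ≥0∞, K ≠ ∞ ∧ L ≠ ∞ ∧
      ∀ᶠ r in atTop, 0 < f r ∧ 0 < g r ∧ f r ≤ K * g r ∧ g r ≤ L * f r := by
  obtain ⟨δ, hδ0, hδ⟩ := exists_between h.1
  obtain ⟨K, hK, hKt⟩ := exists_between h.2
  refine ⟨K, δ⁻¹, hKt.ne, by simpa using hδ0.ne', ?_⟩
  filter_upwards [eventually_lt_of_limsup_lt hK, eventually_lt_of_lt_liminf hδ] with r h1 h2
  have hgt : g r ≠ ∞ := ((hg r).trans_lt ENNReal.one_lt_top).ne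
  have hf0 : f r ≠ 0 := by
    intro h0
    simp [h0] at h2
  have hg0 : g r ≠ 0 := by
    intro h0
    rw [h0, ENNReal.div_zero hf0] at h1
    exact absurd h1 (not_lt.2 le_top)
  have hδt : δ ≠ ∞ := (h2.trans (h1.trans hKt)).ne
  refine ⟨pos_iff_ne_zero.2 hf0, pos_iff_ne_zero.2 hg0, ?_, ?_⟩
  · exact (ENNReal.div_le_iff hg0 hgt).1 h1.le
  · have h3 := (ENNReal.le_div_iff_mul_le (Or.inl hg0) (Or.inl hgt)).1 h2.le
    rw [mul_comm, ← div_eq_mul_inv, ENNReal.le_div_iff_mul_le (Or.inl hδ0.ne') (Or.inl hδt),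
      mul_comm]
    exact h3

theorem asympEquiv_iff {f g : ℝ → ℝ≥0∞} (hf : ∀ r, f r ≤ 1) (hg : ∀ r, g r ≤ 1)
    (hfa : Antitone f) (hga : Antitone g) :
    AsympEquiv f g ↔ (∀ r, 0 < f r) ∧ TailLE f g ∧ TailLE g f := by
  constructor
  · intro h
    obtain ⟨K, L, hK, hL, he⟩ := h.eventually hg
    obtain ⟨R, hR⟩ := eventually_atTop.1 he
    have hf0 : ∀ r, 0 < f r := fun r =>
      (hR (max r R) (le_max_right _ _)).1.trans_le (hfa (le_max_left _ _))
    have hg0 : ∀ r, 0 < g r := fun r =>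
      (hR (max r R) (le_max_right _ _)).2.1.trans_le (hga (le_max_left _ _))
    exact ⟨hf0, TailLE.of_eventually hf hg hga hg0 hK (he.mono fun r h => h.2.2.1),
      TailLE.of_eventually hg hf hfa hf0 hL (he.mono fun r h => h.2.2.2)⟩
  · rintro ⟨h0, h1, h2⟩
    have hg0 := h1.pos h0
    obtain ⟨K, hK⟩ := h1
    obtain ⟨L, hL⟩ := h2
    exact asympEquiv_of_eventually ENNReal.coe_ne_top ENNReal.coe_ne_top (.of_forall hg0)
      (.of_forall fun r => ((hg r).trans_lt ENNReal.one_lt_top).ne) (.of_forall hK) (.of_forall hL)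

/-! ### Tails and the class OS on the half-line. -/

section HalfLine

variable {ζ ξ ζ' ξ' : Measure ℝ≥0}

theorem measurableSet_rightTail (r : ℝ) : MeasurableSet {x : ℝ≥0 | r < (x : ℝ)} :=
  measurableSet_lt measurable_const NNReal.continuous_coe.measurable

theorem rightTail_antitone (ζ : Measure ℝ≥0) : Antitone (rightTail ζ) := fun _ _ h =>
  measure_mono fun _ hx => h.trans_lt hx

theorem rightTail_le_one [IsProbabilityMeasure ζ] (r : ℝ) : rightTail ζ r ≤ 1 := prob_le_one

theorem rightTail_of_neg [IsProbabilityMeasure ζ] {r : ℝ} (hr : r < 0) : rightTail ζ r = 1 := by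
  have : {x : ℝ≥0 | r < (x : ℝ)} = Set.univ := Set.eq_univ_of_forall fun x => hr.trans_le x.2
  rw [rightTail, this, measure_univ]

theorem rightTail_conv_left [SFinite ζ] [SFinite ξ] (r : ℝ) :
    rightTail (ζ.conv ξ) r = ∫⁻ x, rightTail ξ (r - x) ∂ζ := by
  rw [rightTail, ← lintegral_indicator_one (measurableSet_rightTail r),
    Measure.lintegral_conv (measurable_one.indicator (measurableSet_rightTail r))]
  refine lintegral_congr fun x => ?_
  rw [rightTail, ← lintegral_indicator_one (measurableSet_rightTail _)]
  refine lintegral_congr fun y => ?_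
  by_cases h : r < x + y <;> simp [Set.indicator, sub_lt_iff_lt_add', h]

theorem rightTail_conv_right [SFinite ζ] [SFinite ξ] (r : ℝ) :
    rightTail (ζ.conv ξ) r = ∫⁻ x, rightTail ζ (r - x) ∂ξ := by
  rw [Measure.conv_comm, rightTail_conv_left]

/-- Replace one factor at a time, integrating its tail against the other factor and using
commutativity in between. The arguments `r - x` may be negative, hence the bounds are required on
the whole line. -/
theorem rightTail_conv_le [SFinite ζ] [SFinite ξ] [SFinite ζ'] [SFinite ξ'] {K L : ℝ≥0}
    (h : ∀ r, rightTail ζ r ≤ K * rightTail ζ' r) (h' : ∀ r, rightTail ξ r ≤ L * rightTail ξ' r)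
    (r : ℝ) : rightTail (ζ.conv ξ) r ≤ (K * L : ℝ≥0) * rightTail (ζ'.conv ξ') r := by
  calc rightTail (ζ.conv ξ) r = ∫⁻ x, rightTail ξ (r - x) ∂ζ := rightTail_conv_left r
    _ ≤ ∫⁻ x, L * rightTail ξ' (r - x) ∂ζ := lintegral_mono fun x => h' _
    _ = L * rightTail (ζ.conv ξ') r := by
      rw [lintegral_const_mul' _ _ ENNReal.coe_ne_top, rightTail_conv_left]
    _ = L * ∫⁻ x, rightTail ζ (r - x) ∂ξ' := by rw [rightTail_conv_right]
    _ ≤ L * ∫⁻ x, K * rightTail ζ' (r - x) ∂ξ' := by gcongr with x; exact h _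
    _ = (K * L : ℝ≥0) * rightTail (ζ'.conv ξ') r := by
      rw [lintegral_const_mul' _ _ ENNReal.coe_ne_top, rightTail_conv_right, ENNReal.coe_mul]
      ring

theorem TailLE.conv [SFinite ζ] [SFinite ξ] [SFinite ζ'] [SFinite ξ']
    (h : TailLE (rightTail ζ) (rightTail ζ')) (h' : TailLE (rightTail ξ) (rightTail ξ')) :
    TailLE (rightTail (ζ.conv ξ)) (rightTail (ζ'.conv ξ')) := by
  obtain ⟨K, hK⟩ := h
  obtain ⟨L, hL⟩ := h'
  exact ⟨K * L, rightTail_conv_le hK hL⟩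

theorem rightTail_le_conv [SFinite ζ] [IsProbabilityMeasure ξ] (r : ℝ) :
    rightTail ζ r ≤ rightTail (ζ.conv ξ) r := by
  rw [rightTail_conv_right]
  calc rightTail ζ r = ∫⁻ _, rightTail ζ r ∂ξ := by simp
    _ ≤ _ := lintegral_mono fun x => rightTail_antitone ζ (by simp)

theorem mul_rightTail_le_conv [SFinite ζ] [SFinite ξ] (r s : ℝ) :
    rightTail ζ (r - s) * rightTail ξ s ≤ rightTail (ζ.conv ξ) r := by
  rw [rightTail_conv_right]
  calc rightTail ζ (r - s) * rightTail ξ s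
      = ∫⁻ _ in {x : ℝ≥0 | s < (x : ℝ)}, rightTail ζ (r - s) ∂ξ := by
        rw [setLIntegral_const]; rfl
    _ ≤ ∫⁻ x in {x : ℝ≥0 | s < (x : ℝ)}, rightTail ζ (r - x) ∂ξ :=
        setLIntegral_mono' (measurableSet_rightTail s) fun x hx =>
          rightTail_antitone ζ (sub_le_sub_left (le_of_lt hx) r)
    _ ≤ _ := setLIntegral_le_lintegral _ _

/-- Adding a nonnegative variable can only increase the tail, so only the upper bound has content.
-/
theorem isOSubexpHalfLine_iff [IsProbabilityMeasure ζ] :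
    IsOSubexpHalfLine ζ ↔
      (∀ r, 0 < rightTail ζ r) ∧ TailLE (rightTail (ζ.conv ζ)) (rightTail ζ) := by
  rw [IsOSubexpHalfLine, asympEquiv_iff rightTail_le_one rightTail_le_one
    (rightTail_antitone _) (rightTail_antitone _)]
  constructor
  · rintro ⟨h0, h1, _⟩
    exact ⟨h1.pos h0, h1⟩
  · rintro ⟨h0, h1⟩
    exact ⟨fun r => (h0 r).trans_le (rightTail_le_conv r), h1, .of_le rightTail_le_conv⟩

/-- The class `OS` is closed under tail equivalence. -/
theorem IsOSubexpHalfLine.congr [IsProbabilityMeasure ζ] [IsProbabilityMeasure ξ]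
    (h : IsOSubexpHalfLine ζ) (h1 : TailLE (rightTail ζ) (rightTail ξ))
    (h2 : TailLE (rightTail ξ) (rightTail ζ)) : IsOSubexpHalfLine ξ := by
  rw [isOSubexpHalfLine_iff] at h ⊢
  exact ⟨h1.pos h.1, (h2.conv h2).trans (h.2.trans h1)⟩

/-- Tails of distributions in `OS` decrease at most exponentially fast under shifts. -/
theorem IsOSubexpHalfLine.exists_shift [IsProbabilityMeasure ζ] (h : IsOSubexpHalfLine ζ) :
    ∃ (K : ℝ≥0) (b : ℝ), 0 ≤ b ∧ ∀ u, 0 ≤ u → ∀ r,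
      rightTail ζ (r - u) ≤ K * ENNReal.ofReal (Real.exp (b * u)) * rightTail ζ r := by
  obtain ⟨h0, C, hC⟩ := isOSubexpHalfLine_iff.1 h
  have h1 : rightTail ζ 1 ≠ ∞ := ((rightTail_le_one 1).trans_lt ENNReal.one_lt_top).ne
  -- A unit shift costs a constant since `ζ(x > r - 1) ζ(x > 1) ≤ ζ * ζ(x > r) ≤ C ζ(x > r)`. Having
  -- `1 ≤ K` makes the rate `log K` nonnegative and allows rounding `u` up.
  obtain ⟨K, hK1, hK⟩ : ∃ K : ℝ≥0, 1 ≤ K ∧ ∀ r, rightTail ζ (r - 1) ≤ K * rightTail ζ r := by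
    have hfin : 1 + C * (rightTail ζ 1)⁻¹ ≠ ∞ := by
      simp [ENNReal.mul_eq_top, (h0 1).ne']
    refine ⟨(1 + C * (rightTail ζ 1)⁻¹).toNNReal, ?_, fun r => ?_⟩
    · rw [← ENNReal.coe_le_coe, ENNReal.coe_toNNReal hfin]
      exact le_self_add
    · rw [ENNReal.coe_toNNReal hfin]
      have := (mul_rightTail_le_conv (ζ := ζ) (ξ := ζ) r 1).trans (hC r)
      calc rightTail ζ (r - 1) = rightTail ζ (r - 1) * rightTail ζ 1 * (rightTail ζ 1)⁻¹ := by
            rw [mul_assoc, ENNReal.mul_inv_cancel (h0 1).ne' h1, mul_one]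
        _ ≤ C * rightTail ζ r * (rightTail ζ 1)⁻¹ := by gcongr
        _ = C * (rightTail ζ 1)⁻¹ * rightTail ζ r := by ring
        _ ≤ _ := by gcongr; exact le_add_self
  have hn : ∀ (n : ℕ) r, rightTail ζ (r - n) ≤ K ^ n * rightTail ζ r := by
    intro n
    induction n with
    | zero => intro r; simp
    | succ n ih =>
      intro r
      calc rightTail ζ (r - (n + 1 : ℕ)) = rightTail ζ (r - n - 1) := by push_cast; ring_nf
        _ ≤ K * rightTail ζ (r - n) := hK _
        _ ≤ K * (K ^ n * rightTail ζ r) := by gcongr; exact ih r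
        _ = _ := by rw [pow_succ]; ring
  have hK0 : (0 : ℝ) < K := lt_of_lt_of_le one_pos (by exact_mod_cast hK1)
  refine ⟨K, Real.log K, Real.log_nonneg (by exact_mod_cast hK1), fun u hu r => ?_⟩
  calc rightTail ζ (r - u) ≤ rightTail ζ (r - ⌈u⌉₊) :=
        rightTail_antitone ζ (sub_le_sub_left (Nat.le_ceil u) r)
    _ ≤ K ^ ⌈u⌉₊ * rightTail ζ r := hn _ _
    _ ≤ _ := by
      gcongr
      rw [← ENNReal.ofReal_coe_nnreal, ← ENNReal.ofReal_pow hK0.le, ← ENNReal.ofReal_mul hK0.le]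
      apply ENNReal.ofReal_le_ofReal
      calc (K : ℝ) ^ ⌈u⌉₊ = (K : ℝ) ^ ((⌈u⌉₊ : ℕ) : ℝ) := (Real.rpow_natCast _ _).symm
        _ ≤ (K : ℝ) ^ (1 + u) :=
          Real.rpow_le_rpow_of_exponent_le (by exact_mod_cast hK1)
            (by linarith [Nat.ceil_lt_add_one hu])
        _ = _ := by rw [Real.rpow_add hK0, Real.rpow_one, Real.rpow_def_of_pos hK0]

end HalfLine

/-! ### Convolution powers and Kesten's bound. -/

section ConvPower

variable {M : Type*} [AddCommMonoid M] [MeasurableSpace M]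

instance isFiniteMeasure_convPower (μ : Measure M) [IsFiniteMeasure μ] (n : ℕ) :
    IsFiniteMeasure (convPower μ n) := by
  induction n with
  | zero => rw [convPower]; infer_instance
  | succ n ih => rw [convPower]; infer_instance

theorem convPower_smul (μ : Measure M) [IsFiniteMeasure μ] (c : ℝ≥0) (n : ℕ) :
    convPower (c • μ) n = c ^ n • convPower μ n := by
  induction n with
  | zero => simp [convPower]
  | succ n ih =>
    rw [convPower, convPower, ih]
    simp only [ENNReal.smul_def, Measure.conv_smul_right, Measure.conv_smul_left,
      smul_smul, pow_succ', ENNReal.coe_mul]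

variable [MeasurableAdd₂ M]

instance isProbabilityMeasure_convPower (μ : Measure M) [IsProbabilityMeasure μ] (n : ℕ) :
    IsProbabilityMeasure (convPower μ n) := by
  induction n with
  | zero => rw [convPower]; infer_instance
  | succ n ih => rw [convPower]; infer_instance

theorem convPower_one (μ : Measure M) [IsFiniteMeasure μ] : convPower μ 1 = μ := by
  simp [convPower]

theorem convPower_add (μ : Measure M) [IsFiniteMeasure μ] (m n : ℕ) :
    convPower μ (m + n) = (convPower μ m).conv (convPower μ n) := by
  induction n with
  | zero => simp [convPower]
  | succ n ih => rw [← add_assoc, convPower, convPower, ih, Measure.conv_assoc]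

/-- Multiplicative functions integrate multiplicatively against convolution powers. -/
theorem lintegral_convPower (μ : Measure M) [IsFiniteMeasure μ] {f : M → ℝ≥0∞} (hf : Measurable f)
    (h0 : f 0 = 1) (hadd : ∀ x y, f (x + y) = f x * f y) (n : ℕ) :
    ∫⁻ x, f x ∂(convPower μ n) = (∫⁻ x, f x ∂μ) ^ n := by
  induction n with
  | zero => simp [convPower, lintegral_dirac' _ hf, h0]
  | succ n ih =>
    rw [convPower, Measure.lintegral_conv hf, pow_succ, ← ih, ← lintegral_mul_const _ hf]
    refine lintegral_congr fun x => ?_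
    simp_rw [hadd]
    rw [lintegral_const_mul _ hf]

end ConvPower

theorem rightTail_convPower_le {ζ ξ : Measure ℝ≥0} [IsProbabilityMeasure ζ]
    [IsProbabilityMeasure ξ] {K : ℝ≥0} (h : ∀ r, rightTail ζ r ≤ K * rightTail ξ r) (n : ℕ)
    (r : ℝ) : rightTail (convPower ζ n) r ≤ (K ^ n : ℝ≥0) * rightTail (convPower ξ n) r := by
  induction n generalizing r with
  | zero => simp [convPower]
  | succ n ih => rw [convPower, convPower, pow_succ]; exact rightTail_conv_le ih h r

/-- Kesten's bound for the class `OS`. -/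
theorem IsOSubexpHalfLine.exists_convPower_le {ζ : Measure ℝ≥0} [IsProbabilityMeasure ζ]
    (h : IsOSubexpHalfLine ζ) :
    ∃ C : ℝ≥0, ∀ n r, rightTail (convPower ζ n) r ≤ (C ^ n : ℝ≥0) * rightTail ζ r := by
  obtain ⟨-, C, hC⟩ := isOSubexpHalfLine_iff.1 h
  refine ⟨C, fun n => ?_⟩
  induction n with
  | zero =>
    intro r
    rcases lt_or_ge r 0 with hr | hr
    · rw [rightTail_of_neg (ζ := ζ) hr]; simpa using rightTail_le_one (ζ := convPower ζ 0) r
    · have : rightTail (convPower ζ 0) r = 0 := by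
        rw [rightTail, convPower, Measure.dirac_apply' _ (measurableSet_rightTail r)]
        simp [hr]
      rw [this]; exact zero_le
  | succ n ih =>
    intro r
    rw [convPower, pow_succ, ENNReal.coe_mul, mul_assoc]
    refine (rightTail_conv_le (L := 1) ih (ξ' := ζ) (fun r => by simp) r).trans ?_
    rw [mul_one]
    gcongr
    exact hC r

/-! ### Radial tails on Euclidean space and factors with exponential moments. -/

section RadialTail

variable {d : ℕ} {μ ν : Measure (EuclideanSpace ℝ (Fin d))}

theorem measurableSet_normTail (r : ℝ) :
    MeasurableSet {x : EuclideanSpace ℝ (Fin d) | r < ‖x‖} :=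
  measurableSet_lt measurable_const measurable_norm

theorem normTail_antitone (μ : Measure (EuclideanSpace ℝ (Fin d))) : Antitone (normTail μ) :=
  fun _ _ h => measure_mono fun _ hx => h.trans_lt hx

theorem normTail_le_one [IsProbabilityMeasure μ] (r : ℝ) : normTail μ r ≤ 1 := prob_le_one

instance isProbabilityMeasure_radialLaw [IsProbabilityMeasure μ] :
    IsProbabilityMeasure (radialLaw μ) :=
  Measure.isProbabilityMeasure_map measurable_nnnorm.aemeasurable

instance sFinite_radialLaw [SFinite μ] : SFinite (radialLaw μ) := by
  unfold radialLaw; infer_instance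

theorem normTail_eq_rightTail (μ : Measure (EuclideanSpace ℝ (Fin d))) :
    normTail μ = rightTail (radialLaw μ) :=
  funext fun r => (rightTail_radialLaw μ r).symm

theorem normTail_conv [SFinite μ] [SFinite ν] (r : ℝ) :
    normTail (μ.conv ν) r = ∫⁻ x, ν {y | r < ‖x + y‖} ∂μ := by
  rw [normTail, ← lintegral_indicator_one (measurableSet_normTail r),
    Measure.lintegral_conv (measurable_one.indicator (measurableSet_normTail r))]
  refine lintegral_congr fun x => ?_
  rw [← lintegral_indicator_one (measurableSet_lt measurable_const (by fun_prop))]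
  refine lintegral_congr fun y => ?_
  by_cases h : r < ‖x + y‖ <;> simp [Set.indicator, h]

theorem rightTail_conv_radialLaw [SFinite μ] [SFinite ν] (r : ℝ) :
    rightTail ((radialLaw μ).conv (radialLaw ν)) r = ∫⁻ x, normTail ν (r - ‖x‖) ∂μ := by
  rw [rightTail_conv_left, radialLaw, lintegral_map _ measurable_nnnorm]
  · refine lintegral_congr fun x => ?_
    rw [normTail_eq_rightTail]
    rfl
  · exact (rightTail_antitone _).measurable.comp (by fun_prop)

theorem normTail_conv_le [SFinite μ] [SFinite ν] (r : ℝ) :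
    normTail (μ.conv ν) r ≤ rightTail ((radialLaw μ).conv (radialLaw ν)) r := by
  rw [normTail_conv, rightTail_conv_radialLaw]
  refine lintegral_mono fun x => measure_mono fun y (hy : r < ‖x + y‖) => ?_
  have := norm_add_le x y
  show r - ‖x‖ < ‖y‖
  linarith

/-- Cancellation can shorten a sum, so the tail of a factor survives only up to a shift: a summand
of norm at most `a` cannot bring one of norm above `r + a` back within `r`. -/
theorem mul_normTail_le_conv [SFinite μ] [SFinite ν] (r a : ℝ) :
    μ {x | ‖x‖ ≤ a} * normTail ν (r + a) ≤ normTail (μ.conv ν) r := by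
  rw [normTail_conv]
  calc μ {x | ‖x‖ ≤ a} * normTail ν (r + a)
      = ∫⁻ _ in {x | ‖x‖ ≤ a}, normTail ν (r + a) ∂μ := by rw [setLIntegral_const, mul_comm]
    _ ≤ ∫⁻ x in {x | ‖x‖ ≤ a}, ν {y | r < ‖x + y‖} ∂μ := by
      refine setLIntegral_mono' (measurableSet_le measurable_norm measurable_const) fun x hx => ?_
      refine measure_mono fun y (hy : r + a < ‖y‖) => ?_
      have h1 : ‖y‖ ≤ ‖x + y‖ + ‖x‖ := by
        simpa [norm_sub_rev] using norm_sub_le (x + y) x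
      have h2 : ‖x‖ ≤ a := hx
      show r < ‖x + y‖
      linarith
    _ ≤ _ := setLIntegral_le_lintegral _ _

theorem normTail_convPower_le [IsProbabilityMeasure μ] (n : ℕ) (r : ℝ) :
    normTail (convPower μ n) r ≤ rightTail (convPower (radialLaw μ) n) r := by
  induction n generalizing r with
  | zero =>
    refine le_of_eq ?_
    rw [normTail_eq_rightTail, radialLaw, convPower, convPower, Measure.map_dirac' (by fun_prop)]
    simp
  | succ n ih =>
    refine (normTail_conv_le r).trans ?_
    have := rightTail_conv_le (K := 1) (L := 1) (ζ := radialLaw (convPower μ n)) (ξ := radialLaw μ)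
      (ζ' := convPower (radialLaw μ) n) (ξ' := radialLaw μ)
      (fun r => by simpa [rightTail_radialLaw] using ih r) (fun r => by simp) r
    simpa [convPower] using this

theorem ENNReal.le_inv_mul_of_mul_le {p x y : ℝ≥0∞} (h0 : p ≠ 0) (ht : p ≠ ∞) (h : p * x ≤ y) :
    x ≤ p⁻¹ * y := by
  calc x = p⁻¹ * (p * x) := by rw [← mul_assoc, ENNReal.inv_mul_cancel h0 ht, one_mul]
    _ ≤ _ := by gcongr

/-- The eventual form lets finitely many measures share one radius. -/
theorem eventually_measure_closedBall_ne_zero (μ : Measure (EuclideanSpace ℝ (Fin d)))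
    [IsProbabilityMeasure μ] : ∀ᶠ a : ℝ in atTop, 0 ≤ a ∧ μ {x | ‖x‖ ≤ a} ≠ 0 := by
  obtain ⟨n, hn⟩ : ∃ n : ℕ, μ {x | ‖x‖ ≤ n} ≠ 0 := by
    by_contra! h
    have h1 : μ (⋃ n : ℕ, {x | ‖x‖ ≤ n}) = 0 := measure_iUnion_null h
    have h2 : (⋃ n : ℕ, {x : EuclideanSpace ℝ (Fin d) | ‖x‖ ≤ n}) = Set.univ :=
      Set.eq_univ_of_forall fun x => Set.mem_iUnion.2 (exists_nat_ge ‖x‖)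
    simp [h2] at h1
  filter_upwards [eventually_ge_atTop (n : ℝ)] with a ha
  refine ⟨n.cast_nonneg.trans ha, fun h => hn (measure_mono_null (fun x hx => ?_) h)⟩
  exact le_trans hx ha

theorem IsOSubexp.exists_shift [IsProbabilityMeasure μ] (h : IsOSubexp μ) :
    ∃ (K : ℝ≥0) (b : ℝ), 0 ≤ b ∧ ∀ u, 0 ≤ u → ∀ r,
      normTail μ (r - u) ≤ K * ENNReal.ofReal (Real.exp (b * u)) * normTail μ r := by
  rw [normTail_eq_rightTail]
  exact IsOSubexpHalfLine.exists_shift h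

theorem IsOSubexp.exists_shift_const [IsProbabilityMeasure μ] (h : IsOSubexp μ) {a : ℝ}
    (ha : 0 ≤ a) : ∃ K : ℝ≥0, ∀ r, normTail μ r ≤ K * normTail μ (r + a) := by
  obtain ⟨K, b, -, hK⟩ := h.exists_shift
  refine ⟨K * (Real.exp (b * a)).toNNReal, fun r => ?_⟩
  simpa [ENNReal.ofReal] using hK a ha (r + a)

theorem isOSubexp_iff [IsProbabilityMeasure μ] :
    IsOSubexp μ ↔ (∀ r, 0 < normTail μ r) ∧
      TailLE (rightTail ((radialLaw μ).conv (radialLaw μ))) (normTail μ) := by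
  rw [normTail_eq_rightTail]
  exact isOSubexpHalfLine_iff

theorem IsOSubexp.congr [IsProbabilityMeasure μ] [IsProbabilityMeasure ν] (h : IsOSubexp μ)
    (h1 : TailLE (normTail μ) (normTail ν)) (h2 : TailLE (normTail ν) (normTail μ)) :
    IsOSubexp ν := by
  rw [normTail_eq_rightTail, normTail_eq_rightTail] at h1 h2
  exact IsOSubexpHalfLine.congr h h1 h2

/-- A convolution factor of a distribution in `OS` has no heavier tail. -/
theorem IsOSubexp.tailLE_conv_of_conv [IsProbabilityMeasure μ] [IsProbabilityMeasure ν]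
    (h : IsOSubexp (μ.conv ν)) : TailLE (normTail ν) (normTail (μ.conv ν)) := by
  obtain ⟨a, ha, hμ⟩ := (eventually_measure_closedBall_ne_zero μ).exists
  obtain ⟨K, hK⟩ := h.exists_shift_const ha
  have h1 : (μ {x | ‖x‖ ≤ a})⁻¹ ≠ ∞ := by simpa using hμ
  refine ⟨(μ {x | ‖x‖ ≤ a})⁻¹.toNNReal * K, fun r => ?_⟩
  rw [ENNReal.coe_mul, ENNReal.coe_toNNReal h1, mul_assoc]
  refine ENNReal.le_inv_mul_of_mul_le hμ (by finiteness) ?_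
  calc μ {x | ‖x‖ ≤ a} * normTail ν r ≤ normTail (μ.conv ν) (r - a) := by
        simpa using mul_normTail_le_conv (μ := μ) (ν := ν) (r - a) a
    _ ≤ _ := by simpa using hK (r - a)

/-- Convolving a distribution in `OS` with another one does not make its tail lighter. -/
theorem IsOSubexp.tailLE_conv [IsProbabilityMeasure μ] [IsProbabilityMeasure ν]
    (h : IsOSubexp ν) : TailLE (normTail ν) (normTail (μ.conv ν)) := by
  obtain ⟨a, ha, hμ⟩ := (eventually_measure_closedBall_ne_zero μ).exists
  obtain ⟨K, hK⟩ := h.exists_shift_const ha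
  have h1 : (μ {x | ‖x‖ ≤ a})⁻¹ ≠ ∞ := by simpa using hμ
  refine ⟨K * (μ {x | ‖x‖ ≤ a})⁻¹.toNNReal, fun r => (hK r).trans ?_⟩
  rw [ENNReal.coe_mul, ENNReal.coe_toNNReal h1, mul_assoc]
  gcongr
  exact ENNReal.le_inv_mul_of_mul_le hμ (by finiteness) (mul_normTail_le_conv r a)

/-- If `μ^{n*}` is in `OS`, the tails of all convolution powers of the norm law of `μ` are bounded
by geometric multiples of its tail. -/
theorem IsOSubexp.exists_rightTail_convPower_le [IsProbabilityMeasure μ] {n : ℕ} (hn : 0 < n)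
    (h : IsOSubexp (convPower μ n)) :
    ∃ C : ℝ≥0, ∀ k r, rightTail (convPower (radialLaw μ) k) r ≤
      (C ^ k : ℝ≥0) * normTail (convPower μ n) r := by
  -- As `n = m + 1`, `μ` is a factor of `convPower μ n`, so its tail is no heavier. Kesten's bound
  -- for the radial law of that power then transfers to `radialLaw μ`.
  obtain ⟨m, rfl⟩ := Nat.exists_eq_succ_of_ne_zero hn.ne'
  have h1 : IsOSubexp ((convPower μ m).conv μ) := h
  obtain ⟨D, hD⟩ := h1.tailLE_conv_of_conv
  obtain ⟨C, hC⟩ := IsOSubexpHalfLine.exists_convPower_le h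
  rw [normTail_eq_rightTail, normTail_eq_rightTail] at hD
  refine ⟨D * C, fun k r => ?_⟩
  rw [normTail_eq_rightTail, mul_pow, ENNReal.coe_mul, mul_assoc]
  refine (rightTail_convPower_le hD k r).trans ?_
  gcongr
  exact hC k r

/-- All exponential moments of the norm are finite. -/
def HasExpMoments (ν : Measure (EuclideanSpace ℝ (Fin d))) : Prop :=
  ∀ b : ℝ, ∫⁻ x, ENNReal.ofReal (Real.exp (b * ‖x‖)) ∂ν < ∞

/-- The exponential cost of shifts is integrated against `ν`. -/
theorem IsOSubexp.tailLE_conv_right [IsProbabilityMeasure μ] [IsProbabilityMeasure ν]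
    (h : IsOSubexp μ) (hν : HasExpMoments ν) : TailLE (normTail (ν.conv μ)) (normTail μ) := by
  obtain ⟨K, b, hb, hK⟩ := h.exists_shift
  refine ⟨K * (∫⁻ x, ENNReal.ofReal (Real.exp (b * ‖x‖)) ∂ν).toNNReal, fun r => ?_⟩
  rw [ENNReal.coe_mul, ENNReal.coe_toNNReal (hν b).ne]
  refine (normTail_conv_le r).trans ?_
  rw [rightTail_conv_radialLaw]
  calc ∫⁻ x, normTail μ (r - ‖x‖) ∂ν
      ≤ ∫⁻ x, K * ENNReal.ofReal (Real.exp (b * ‖x‖)) * normTail μ r ∂ν :=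
        lintegral_mono fun x => hK _ (norm_nonneg x) r
    _ = _ := by
      rw [lintegral_mul_const _ (by fun_prop), lintegral_const_mul _ (by fun_prop)]

/-- A factor with all exponential moments does not contribute to a tail in `OS`. -/
theorem IsOSubexp.tailLE_of_conv [IsProbabilityMeasure μ] [IsProbabilityMeasure ν]
    (h : IsOSubexp (ν.conv μ)) (hν : HasExpMoments ν) :
    TailLE (normTail (ν.conv μ)) (normTail μ) := by
  obtain ⟨K, b, hb, hK⟩ := h.exists_shift
  obtain ⟨C, hC⟩ := h.tailLE_conv_of_conv
  set g : EuclideanSpace ℝ (Fin d) → ℝ≥0∞ := fun x => ENNReal.ofReal (Real.exp (b * ‖x‖))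
  have hg : Measurable g := by fun_prop
  -- The cutoff `n` is such that values of `ν` beyond it contribute at most half of the tail being
  -- estimated. That half is finite and is absorbed on the left; the remaining shift by `n` costs a
  -- constant.
  obtain ⟨n, hn⟩ : ∃ n : ℕ, C * K * ∫⁻ x in {x | (n : ℝ) < ‖x‖}, g x ∂ν ≤ 2⁻¹ := by
    have h1 : Tendsto (fun n : ℕ => (ν.withDensity g) {x | (n : ℝ) < ‖x‖}) atTop (nhds 0) := by
      have h2 : (⋂ n : ℕ, {x : EuclideanSpace ℝ (Fin d) | (n : ℝ) < ‖x‖}) = ∅ := by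
        refine Set.eq_empty_of_forall_notMem fun x hx => ?_
        obtain ⟨n, hn⟩ := exists_nat_ge ‖x‖
        exact absurd (Set.mem_iInter.1 hx n) (not_lt.2 hn)
      rw [← measure_empty (μ := ν.withDensity g), ← h2]
      refine tendsto_measure_iInter_atTop
        (fun n => (measurableSet_normTail _).nullMeasurableSet)
        (fun m n hmn x (hx : (n : ℝ) < ‖x‖) => lt_of_le_of_lt (by exact_mod_cast hmn) hx)
        ⟨0, ?_⟩
      rw [withDensity_apply _ (measurableSet_normTail _)]
      exact ((setLIntegral_le_lintegral _ _).trans_lt (hν b)).ne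
    have h3 := ENNReal.Tendsto.const_mul (a := (C * K : ℝ≥0∞)) h1 (Or.inr (by finiteness))
    rw [mul_zero] at h3
    obtain ⟨n, hn⟩ := (h3.eventually_le_const (u := 2⁻¹) (by simp)).exists
    refine ⟨n, ?_⟩
    rwa [withDensity_apply _ (measurableSet_normTail _)] at hn
  have h2 : ∀ r, normTail (ν.conv μ) r ≤ 2 * normTail μ (r - n) := by
    intro r
    have hle : normTail (ν.conv μ) r ≤ normTail μ (r - n) + 2⁻¹ * normTail (ν.conv μ) r := by
      calc normTail (ν.conv μ) r ≤ ∫⁻ x, normTail μ (r - ‖x‖) ∂ν := by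
            rw [← rightTail_conv_radialLaw]; exact normTail_conv_le r
        _ = ∫⁻ x in {x | (n : ℝ) < ‖x‖}ᶜ, normTail μ (r - ‖x‖) ∂ν +
            ∫⁻ x in {x | (n : ℝ) < ‖x‖}, normTail μ (r - ‖x‖) ∂ν := by
            rw [add_comm, lintegral_add_compl _ (measurableSet_normTail _)]
        _ ≤ ∫⁻ x in {x | (n : ℝ) < ‖x‖}ᶜ, normTail μ (r - n) ∂ν +
            ∫⁻ x in {x | (n : ℝ) < ‖x‖}, C * K * g x * normTail (ν.conv μ) r ∂ν := by
            gcongr ?_ + ?_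
            · refine setLIntegral_mono' (measurableSet_normTail _).compl fun x hx => ?_
              refine normTail_antitone μ (sub_le_sub_left ?_ r)
              exact not_lt.1 hx
            · refine lintegral_mono fun x => ?_
              refine (hC _).trans ?_
              rw [mul_assoc, mul_assoc, ← mul_assoc (K : ℝ≥0∞)]
              gcongr
              exact hK _ (norm_nonneg x) r
        _ ≤ _ := by
            gcongr ?_ + ?_
            · rw [setLIntegral_const]
              exact mul_le_of_le_one_right' prob_le_one
            · rw [lintegral_mul_const _ (by fun_prop), lintegral_const_mul _ hg]
              gcongr
    have hfin : 2⁻¹ * normTail (ν.conv μ) r ≠ ∞ :=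
      ENNReal.mul_ne_top (by simp) ((normTail_le_one r).trans_lt ENNReal.one_lt_top).ne
    have h3 : normTail (ν.conv μ) r
        = 2⁻¹ * normTail (ν.conv μ) r + 2⁻¹ * normTail (ν.conv μ) r := by
      rw [← add_mul, ENNReal.inv_two_add_inv_two, one_mul]
    have h4 : 2⁻¹ * normTail (ν.conv μ) r ≤ normTail μ (r - n) := by
      rw [add_comm] at hle
      refine (ENNReal.add_le_add_iff_left hfin).1 ?_
      exact h3 ▸ hle
    calc normTail (ν.conv μ) r = 2 * (2⁻¹ * normTail (ν.conv μ) r) := by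
          rw [← mul_assoc, ENNReal.mul_inv_cancel (by simp) (by simp), one_mul]
      _ ≤ _ := by gcongr
  obtain ⟨D, hD⟩ := h.exists_shift_const (a := n) n.cast_nonneg
  refine ⟨D * 2, fun r => (hD r).trans ?_⟩
  rw [ENNReal.coe_mul, mul_assoc]
  gcongr
  simpa using h2 (r + n)

end RadialTail

/-! ### Compound Poisson distributions. -/

noncomputable section

open scoped Nat

section CompoundPoisson

variable {M : Type*} [MeasurableSpace M]

/-- The weight `e^{-λ(M)} / k!` of `λ^{k*}` in the compound Poisson distribution of `λ`. -/
def poissonWeight (lam : Measure M) (k : ℕ) : ℝ≥0∞ :=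
  ENNReal.ofReal (Real.exp (-lam.real Set.univ) / k !)

theorem poissonWeight_pos (lam : Measure M) (k : ℕ) : 0 < poissonWeight lam k :=
  ENNReal.ofReal_pos.2 (by positivity)

theorem tsum_poissonWeight_mul_pow (lam : Measure M) {x : ℝ} (hx : 0 ≤ x) :
    ∑' k, poissonWeight lam k * ENNReal.ofReal x ^ k
      = ENNReal.ofReal (Real.exp (x - lam.real Set.univ)) := by
  have h : HasSum (fun k : ℕ => Real.exp (-lam.real Set.univ) / k ! * x ^ k)
      (Real.exp (-lam.real Set.univ) * Real.exp x) := by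
    have h1 := (NormedSpace.expSeries_div_hasSum_exp x).mul_left (Real.exp (-lam.real Set.univ))
    rw [← Real.exp_eq_exp_ℝ] at h1
    simpa only [mul_div_assoc', div_mul_eq_mul_div] using h1
  calc _ = ∑' k, ENNReal.ofReal (Real.exp (-lam.real Set.univ) / k ! * x ^ k) := by
        refine tsum_congr fun k => ?_
        rw [poissonWeight, ENNReal.ofReal_mul (by positivity), ENNReal.ofReal_pow hx]
    _ = _ := by
        rw [← ENNReal.ofReal_tsum_of_nonneg (fun k => by positivity) h.summable, h.tsum_eq,
          ← Real.exp_add]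
        congr 2
        ring

variable [AddCommMonoid M]

/-- The compound Poisson distribution with finite Lévy measure `λ`. -/
def compoundPoisson (lam : Measure M) : Measure M :=
  Measure.sum fun k => poissonWeight lam k • convPower lam k

theorem lintegral_compoundPoisson (lam : Measure M) (f : M → ℝ≥0∞) :
    ∫⁻ x, f x ∂(compoundPoisson lam)
      = ∑' k, poissonWeight lam k * ∫⁻ x, f x ∂(convPower lam k) := by
  simp [compoundPoisson, lintegral_sum_measure, lintegral_smul_measure]

theorem compoundPoisson_apply (lam : Measure M) {s : Set M} (hs : MeasurableSet s) :
    compoundPoisson lam s = ∑' k, poissonWeight lam k * convPower lam k s := by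
  simp [compoundPoisson, Measure.sum_apply _ hs]

variable [MeasurableAdd₂ M]

/-- Integrals of a multiplicative function over convolution powers are powers, so the Poisson series
is an exponential series. The function `1` gives the total mass, real exponentials the Laplace
transform. -/
theorem lintegral_compoundPoisson_of_mul (lam : Measure M) [IsFiniteMeasure lam] {f : M → ℝ≥0∞}
    (hf : Measurable f) (h0 : f 0 = 1) (hadd : ∀ x y, f (x + y) = f x * f y)
    (hfin : ∫⁻ x, f x ∂lam ≠ ∞) :
    ∫⁻ x, f x ∂(compoundPoisson lam)
      = ENNReal.ofReal (Real.exp ((∫⁻ x, f x ∂lam).toReal - lam.real Set.univ)) := by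
  rw [lintegral_compoundPoisson, ← tsum_poissonWeight_mul_pow lam ENNReal.toReal_nonneg]
  refine tsum_congr fun k => ?_
  rw [lintegral_convPower lam hf h0 hadd, ENNReal.ofReal_toReal hfin]

instance isProbabilityMeasure_compoundPoisson (lam : Measure M) [IsFiniteMeasure lam] :
    IsProbabilityMeasure (compoundPoisson lam) := by
  constructor
  have h := lintegral_compoundPoisson_of_mul lam (f := fun _ => 1) measurable_const rfl
    (by simp) (by simp)
  simpa [Measure.real] using h

end CompoundPoisson

section CharFun

variable {d : ℕ}

theorem charFun_convPower (lam : Measure (EuclideanSpace ℝ (Fin d))) [IsFiniteMeasure lam]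
    (n : ℕ) (z : EuclideanSpace ℝ (Fin d)) :
    charFun (convPower lam n) z = charFun lam z ^ n := by
  induction n with
  | zero => simp [convPower]
  | succ n ih => rw [convPower, charFun_conv, ih, pow_succ]

theorem charFun_compoundPoisson (lam : Measure (EuclideanSpace ℝ (Fin d))) [IsFiniteMeasure lam]
    (z : EuclideanSpace ℝ (Fin d)) :
    charFun (compoundPoisson lam) z = Complex.exp (charFun lam z - lam.real Set.univ) := by
  have hint : Integrable (fun x => Complex.exp (inner ℝ x z * Complex.I)) (compoundPoisson lam) := by
    refine Integrable.of_bound (by fun_prop) 1 (.of_forall fun x => ?_)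
    rw [Complex.norm_exp_ofReal_mul_I]
  have h1 := hasSum_integral_measure hint
  have h2 : HasSum (fun k : ℕ => (Real.exp (-lam.real Set.univ) : ℂ) * (charFun lam z ^ k / k !))
      ((Real.exp (-lam.real Set.univ) : ℂ) * Complex.exp (charFun lam z)) := by
    rw [Complex.exp_eq_exp_ℂ]
    exact (NormedSpace.expSeries_div_hasSum_exp (charFun lam z)).mul_left _
  rw [sub_eq_neg_add, Complex.exp_add]
  rw [← Complex.ofReal_neg, ← Complex.ofReal_exp, charFun_apply]
  refine h1.unique (Eq.subst (motive := fun f => HasSum f _) (funext fun k => ?_) h2)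
  rw [integral_smul_measure, ← charFun_apply, charFun_convPower, poissonWeight,
    ENNReal.toReal_ofReal (by positivity), Complex.real_smul]
  push_cast
  ring

/-- This turns a bound on the self-convolution into a comparison of two series differing by the
weights `2 ^ k`. -/
theorem compoundPoisson_conv_self (lam : Measure (EuclideanSpace ℝ (Fin d)))
    [IsFiniteMeasure lam] :
    (compoundPoisson lam).conv (compoundPoisson lam) = compoundPoisson ((2 : ℝ≥0) • lam) := by
  refine Measure.ext_of_charFun (funext fun z => ?_)
  rw [charFun_conv, charFun_compoundPoisson, charFun_compoundPoisson, ← Complex.exp_add]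
  congr 1
  have h1 : charFun ((2 : ℝ≥0) • lam) z = 2 * charFun lam z := by
    rw [charFun_apply, charFun_apply, ENNReal.smul_def, integral_smul_measure]
    simp [Complex.real_smul]
  rw [h1, measureReal_nnreal_smul_apply]
  push_cast
  ring

end CharFun

/-- Terms from index `N` on have weight at least `2 ^ N ≥ 2 * C`, so they make up at most half of
the sum; finiteness lets that half be cancelled. -/
theorem tsum_le_two_mul_sum_range {v : ℕ → ℝ≥0∞} {C : ℝ≥0∞} {N : ℕ} (hN : 2 * C ≤ 2 ^ N)
    (hC0 : C ≠ 0) (hC : C ≠ ∞) (hv : ∑' k, v k ≠ ∞) (h : ∑' k, 2 ^ k * v k ≤ C * ∑' k, v k) :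
    ∑' k, v k ≤ 2 * ∑ k ∈ Finset.range N, v k := by
  have hsplit : ∑ k ∈ Finset.range N, v k + ∑' k, v (k + N) = ∑' k, v k :=
    ENNReal.summable.sum_add_tsum_nat_add'
  have h1 : 2 * C * ∑' k, v (k + N) ≤ C * ∑' k, v k := by
    calc 2 * C * ∑' k, v (k + N) ≤ 2 ^ N * ∑' k, v (k + N) := by gcongr
      _ = ∑' k, 2 ^ N * v (k + N) := ENNReal.tsum_mul_left.symm
      _ ≤ ∑' k, 2 ^ (k + N) * v (k + N) := by
        refine ENNReal.tsum_le_tsum fun k => ?_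
        gcongr
        · norm_num
        · omega
      _ ≤ ∑' k, 2 ^ k * v k := ENNReal.tsum_comp_le_tsum_of_injective (add_left_injective N) _
      _ ≤ _ := h
  rw [mul_comm 2 C, mul_assoc, ENNReal.mul_le_mul_iff_right hC0 hC, ← hsplit, two_mul] at h1
  have h2 : ∑' k, v (k + N) ≠ ∞ := fun h => hv (by rw [← hsplit, h]; simp)
  rw [← hsplit, two_mul]
  gcongr
  exact (ENNReal.add_le_add_iff_right h2).1 h1

/-! ### Compound Poisson tails against tails of convolution powers. -/

section Tails

variable {d : ℕ} {μ : Measure (EuclideanSpace ℝ (Fin d))} [IsProbabilityMeasure μ]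

theorem normTail_compoundPoisson_smul (c : ℝ≥0) (r : ℝ) :
    normTail (compoundPoisson (c • μ)) r
      = ∑' k, poissonWeight (c • μ) k * (c ^ k * normTail (convPower μ k) r) := by
  rw [normTail, compoundPoisson_apply _ (measurableSet_normTail r)]
  refine tsum_congr fun k => ?_
  rw [convPower_smul, Measure.smul_apply, ← ENNReal.coe_pow]
  rfl

/-- One term of the Poisson series suffices. -/
theorem tailLE_compoundPoisson {c : ℝ≥0} (hc : c ≠ 0) (n : ℕ) :
    TailLE (normTail (convPower μ n)) (normTail (compoundPoisson (c • μ))) := by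
  have h0 : poissonWeight (c • μ) n * c ^ n ≠ 0 :=
    mul_ne_zero (poissonWeight_pos _ _).ne' (by simp [hc])
  have ht : poissonWeight (c • μ) n * c ^ n ≠ ∞ :=
    ENNReal.mul_ne_top ENNReal.ofReal_ne_top (by finiteness)
  refine ⟨(poissonWeight (c • μ) n * c ^ n)⁻¹.toNNReal, fun r => ?_⟩
  rw [ENNReal.coe_toNNReal (by simpa using h0)]
  refine ENNReal.le_inv_mul_of_mul_le h0 ht ?_
  rw [normTail_compoundPoisson_smul, mul_assoc]
  exact ENNReal.le_tsum n

theorem IsOSubexp.compoundPoisson_tailLE {n : ℕ} (hn : 0 < n) (h : IsOSubexp (convPower μ n))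
    (c : ℝ≥0) : TailLE (normTail (compoundPoisson (c • μ))) (normTail (convPower μ n)) := by
  obtain ⟨C, hC⟩ := h.exists_rightTail_convPower_le hn
  refine ⟨(Real.exp ((c * C : ℝ≥0) - (c • μ).real Set.univ)).toNNReal, fun r => ?_⟩
  change _ ≤ ENNReal.ofReal _ * _
  rw [← tsum_poissonWeight_mul_pow (c • μ) (NNReal.coe_nonneg (c * C)), ← ENNReal.tsum_mul_right,
    normTail_compoundPoisson_smul]
  refine ENNReal.tsum_le_tsum fun k => ?_
  rw [mul_assoc, ENNReal.ofReal_coe_nnreal, ENNReal.coe_mul, mul_pow, mul_assoc]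
  gcongr
  exact (normTail_convPower_le k r).trans (by simpa using hC k r)

/-- If a compound Poisson distribution is in `OS`, its tail is dominated by that of a convolution
power of the jump distribution. -/
theorem IsOSubexp.exists_tailLE_convPower {c : ℝ≥0}
    (h : IsOSubexp (compoundPoisson (c • μ))) :
    ∃ N, 0 < N ∧ TailLE (normTail (compoundPoisson (c • μ))) (normTail (convPower μ N)) := by
  obtain ⟨-, C, hC⟩ := isOSubexp_iff.1 h
  set m : ℝ := (c • μ).real Set.univ with hm
  -- The normalizations `e^{-m}` and `e^{-2m}` are taken out, so that the law and its
  -- self-convolution share the terms `v r k` up to `2 ^ k`.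
  set v : ℝ → ℕ → ℝ≥0∞ := fun r k =>
    ENNReal.ofReal (1 / k !) * (c ^ k * normTail (convPower μ k) r) with hv
  have hw : ∀ k, poissonWeight (c • μ) k = ENNReal.ofReal (Real.exp (-m)) *
      ENNReal.ofReal (1 / k !) := fun k => by
    rw [poissonWeight, ← ENNReal.ofReal_mul (by positivity), mul_one_div]
  have he0 : ∀ x, ENNReal.ofReal (Real.exp x) ≠ 0 := fun x => by
    simpa using Real.exp_pos x
  have hT : ∀ r, normTail (compoundPoisson (c • μ)) r
      = ENNReal.ofReal (Real.exp (-m)) * ∑' k, v r k := fun r => by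
    rw [normTail_compoundPoisson_smul, ← ENNReal.tsum_mul_left]
    refine tsum_congr fun k => ?_
    rw [hw, mul_assoc]
  have hT2 : ∀ r, normTail ((compoundPoisson (c • μ)).conv (compoundPoisson (c • μ))) r
      = ENNReal.ofReal (Real.exp (-m)) ^ 2 * ∑' k, 2 ^ k * v r k := fun r => by
    rw [compoundPoisson_conv_self, smul_smul, normTail_compoundPoisson_smul,
      ← ENNReal.tsum_mul_left]
    refine tsum_congr fun k => ?_
    have h1 : poissonWeight ((2 * c) • μ) k
        = ENNReal.ofReal (Real.exp (-m)) ^ 2 * ENNReal.ofReal (1 / k !) := by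
      rw [poissonWeight, ← ENNReal.ofReal_pow (by positivity), ← ENNReal.ofReal_mul (by positivity),
        ← Real.exp_nat_mul, mul_one_div, mul_smul, measureReal_nnreal_smul_apply, ← hm]
      congr 3
      push_cast
      ring
    rw [h1, ENNReal.coe_mul, mul_pow, hv]
    push_cast
    ring
  have hfin : ∀ r, ∑' k, v r k ≠ ∞ := fun r hr => by
    have := normTail_le_one (μ := compoundPoisson (c • μ)) r
    rw [hT, hr, ENNReal.mul_top (he0 _)] at this
    simp at this
  -- The term `e^m C` is what remains after cancelling `e^{-m}`; the added `1` makes `D` nonzero.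
  set D : ℝ≥0∞ := 1 + (ENNReal.ofReal (Real.exp (-m)))⁻¹ * C with hD
  have hDt : D ≠ ∞ := by
    have := he0 (-m)
    simp only [hD]
    finiteness
  have hD0 : D ≠ 0 := by simp [hD]
  have hle : ∀ r, ∑' k, 2 ^ k * v r k ≤ D * ∑' k, v r k := fun r => by
    have h1 := (normTail_conv_le r).trans (hC r)
    rw [hT2, hT, pow_two, mul_assoc, mul_left_comm (C : ℝ≥0∞),
      ENNReal.mul_le_mul_iff_right (he0 _) ENNReal.ofReal_ne_top] at h1
    refine (ENNReal.le_inv_mul_of_mul_le (he0 _) ENNReal.ofReal_ne_top h1).trans ?_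
    rw [← mul_assoc]
    gcongr
    exact le_add_self
  obtain ⟨N, hN0, hN⟩ : ∃ N : ℕ, 0 < N ∧ 2 * D ≤ 2 ^ N := by
    have h1 : Tendsto (fun N : ℕ => (2 : ℝ≥0∞) ^ N) atTop (nhds ∞) :=
      ENNReal.tendsto_pow_atTop_nhds_top_iff.2 (by norm_num)
    obtain ⟨N, hN, hN0⟩ := ((h1.eventually_const_le (u := 2 * D) (by finiteness)).and
      (eventually_gt_atTop 0)).exists
    exact ⟨N, hN0, hN⟩
  refine ⟨N, hN0, ?_⟩
  obtain ⟨a, hball, ha⟩ : ∃ a : ℝ, (∀ j ∈ Finset.range (N + 1),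
      0 ≤ a ∧ convPower μ j {x | ‖x‖ ≤ a} ≠ 0) ∧ 0 ≤ a :=
    (((Finset.eventually_all _).2 fun j _ =>
      eventually_measure_closedBall_ne_zero (convPower μ j)).and (eventually_ge_atTop 0)).exists
  obtain ⟨K, hK⟩ := h.exists_shift_const ha
  -- The `k` jumps are completed to `N` by `N - k` more whose sum stays in the ball of radius `a`.
  have hpow : ∀ k ∈ Finset.range N, ∀ r, normTail (convPower μ k) (r + a) ≤
      (convPower μ (N - k) {x | ‖x‖ ≤ a})⁻¹ * normTail (convPower μ N) r := by
    intro k hk r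
    have hk' := Finset.mem_range.1 hk
    refine ENNReal.le_inv_mul_of_mul_le (hball (N - k) (Finset.mem_range.2 (by omega))).2
      (by finiteness) ?_
    have h1 := mul_normTail_le_conv (μ := convPower μ (N - k)) (ν := convPower μ k) r a
    rwa [← convPower_add, Nat.sub_add_cancel hk'.le] at h1
  set B : ℝ≥0∞ := ENNReal.ofReal (Real.exp (-m)) * (2 * ∑ k ∈ Finset.range N,
    ENNReal.ofReal (1 / k !) * (c ^ k * (convPower μ (N - k) {x | ‖x‖ ≤ a})⁻¹)) with hB
  have hBt : B ≠ ∞ := by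
    refine ENNReal.mul_ne_top ENNReal.ofReal_ne_top (ENNReal.mul_ne_top (by simp) ?_)
    refine ENNReal.sum_ne_top.2 fun k hk => ENNReal.mul_ne_top ENNReal.ofReal_ne_top ?_
    refine ENNReal.mul_ne_top (by finiteness) ?_
    have hk' := Finset.mem_range.1 hk
    simpa using (hball (N - k) (Finset.mem_range.2 (by omega))).2
  refine ⟨K * B.toNNReal, fun r => (hK r).trans ?_⟩
  rw [ENNReal.coe_mul, ENNReal.coe_toNNReal hBt, mul_assoc]
  gcongr
  calc normTail (compoundPoisson (c • μ)) (r + a)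
      ≤ ENNReal.ofReal (Real.exp (-m)) * (2 * ∑ k ∈ Finset.range N, v (r + a) k) := by
        rw [hT]
        gcongr
        exact tsum_le_two_mul_sum_range hN hD0 hDt (hfin _) (hle _)
    _ ≤ ENNReal.ofReal (Real.exp (-m)) * (2 * ∑ k ∈ Finset.range N, ENNReal.ofReal (1 / k !) *
          (c ^ k * ((convPower μ (N - k) {x | ‖x‖ ≤ a})⁻¹ * normTail (convPower μ N) r))) := by
        gcongr with k hk
        simp only [hv]
        gcongr
        exact hpow k hk r
    _ = B * normTail (convPower μ N) r := by
        rw [hB, mul_assoc, mul_assoc, Finset.sum_mul]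
        simp only [mul_assoc]

end Tails

end

/-! ### Criteria for exponential moments. -/

section ExpMoments

variable {d : ℕ} {μ ν : Measure (EuclideanSpace ℝ (Fin d))}

theorem HasExpMoments.of_nonneg
    (h : ∀ b : ℝ, 0 ≤ b → ∫⁻ x, ENNReal.ofReal (Real.exp (b * ‖x‖)) ∂ν < ∞) : HasExpMoments ν := by
  intro b
  refine lt_of_le_of_lt (lintegral_mono fun x => ?_) (h |b| (abs_nonneg b))
  gcongr
  exact le_abs_self b

theorem HasExpMoments.conv [SFinite μ] [SFinite ν] (hμ : HasExpMoments μ) (hν : HasExpMoments ν) :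
    HasExpMoments (μ.conv ν) := by
  refine .of_nonneg fun b hb => ?_
  rw [Measure.lintegral_conv (by fun_prop)]
  calc ∫⁻ x, ∫⁻ y, ENNReal.ofReal (Real.exp (b * ‖x + y‖)) ∂ν ∂μ
      ≤ ∫⁻ x, ∫⁻ y, ENNReal.ofReal (Real.exp (b * ‖x‖)) *
          ENNReal.ofReal (Real.exp (b * ‖y‖)) ∂ν ∂μ := by
        refine lintegral_mono fun x => lintegral_mono fun y => ?_
        rw [← ENNReal.ofReal_mul (by positivity), ← Real.exp_add, ← mul_add]
        gcongr
        exact norm_add_le x y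
    _ = (∫⁻ x, ENNReal.ofReal (Real.exp (b * ‖x‖)) ∂μ) *
          ∫⁻ y, ENNReal.ofReal (Real.exp (b * ‖y‖)) ∂ν := by
        simp_rw [lintegral_const_mul' _ _ ENNReal.ofReal_ne_top]
        rw [lintegral_mul_const _ (by fun_prop)]
    _ < ∞ := ENNReal.mul_lt_top (hμ b) (hν b)

/-- Fernique's theorem provides a finite integral of `exp (C ‖x‖²)`, and `b t ≤ b² / (4C) + C t²`.
-/
theorem hasExpMoments_of_isGaussian [ProbabilityTheory.IsGaussian μ] : HasExpMoments μ := by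
  obtain ⟨C, hC, hint⟩ := ProbabilityTheory.IsGaussian.exists_integrable_exp_sq μ
  intro b
  have h1 : Integrable (fun x => Real.exp (b ^ 2 / (4 * C)) * Real.exp (C * ‖x‖ ^ 2)) μ :=
    hint.const_mul _
  refine lt_of_le_of_lt (lintegral_mono fun x => ?_) h1.lintegral_lt_top
  rw [← Real.exp_add]
  gcongr
  have h2 : b ^ 2 / (4 * C) + C * ‖x‖ ^ 2 - b * ‖x‖ = (b - 2 * C * ‖x‖) ^ 2 / (4 * C) := by
    field_simp
    ring
  have h3 : 0 ≤ (b - 2 * C * ‖x‖) ^ 2 / (4 * C) := by positivity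
  linarith

theorem exists_norm_le_card_mul_abs_apply (x : EuclideanSpace ℝ (Fin d)) :
    x = 0 ∨ ∃ i, ‖x‖ ≤ d * |x i| := by
  rcases isEmpty_or_nonempty (Fin d) with h | h
  · exact Or.inl (Subsingleton.elim _ _)
  · right
    obtain ⟨i, hi⟩ := Finite.exists_max fun i => |x i|
    refine ⟨i, ?_⟩
    calc ‖x‖ = ‖∑ j, x j • EuclideanSpace.single j (1 : ℝ)‖ := by
          congr 1
          ext j
          simp [Finset.sum_apply, Pi.single_apply]
      _ ≤ ∑ j, ‖x j • EuclideanSpace.single j (1 : ℝ)‖ := norm_sum_le _ _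
      _ = ∑ j, |x j| := by simp [norm_smul]
      _ ≤ ∑ _j : Fin d, |x i| := Finset.sum_le_sum fun j _ => hi j
      _ = d * |x i| := by simp

/-- Finiteness of the Laplace transform gives all exponential moments. -/
theorem hasExpMoments_of_inner [IsFiniteMeasure ν]
    (h : ∀ w, ∫⁻ x, ENNReal.ofReal (Real.exp (inner ℝ w x)) ∂ν < ∞) : HasExpMoments ν := by
  refine .of_nonneg fun b hb => ?_
  -- The coordinate of largest modulus controls the norm up to the factor `d`, and both signs are
  -- included in the sum. The constant `1` covers `x = 0`, in particular `d = 0`.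
  have hle : ∀ x : EuclideanSpace ℝ (Fin d), ENNReal.ofReal (Real.exp (b * ‖x‖)) ≤
      1 + ∑ i, (ENNReal.ofReal (Real.exp (inner ℝ (EuclideanSpace.single i (b * d)) x)) +
        ENNReal.ofReal (Real.exp (inner ℝ (EuclideanSpace.single i (-(b * d))) x))) := by
    intro x
    rcases exists_norm_le_card_mul_abs_apply x with rfl | ⟨i, hi⟩
    · simp
    · refine le_trans ?_ le_add_self
      refine le_trans ?_ (Finset.single_le_sum (fun _ _ => zero_le) (Finset.mem_univ i))
      have h1 : b * ‖x‖ ≤ b * d * |x i| := by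
        rw [mul_assoc]
        gcongr
      rcases abs_cases (x i) with ⟨h2, -⟩ | ⟨h2, -⟩
      · refine le_trans ?_ le_self_add
        gcongr
        simpa [EuclideanSpace.inner_single_left, h2] using h1
      · refine le_trans ?_ le_add_self
        gcongr
        simpa [EuclideanSpace.inner_single_left, h2] using h1
  refine (lintegral_mono hle).trans_lt ?_
  rw [lintegral_add_left measurable_const, lintegral_finsetSum _ (fun i _ => by fun_prop)]
  refine ENNReal.add_lt_top.2 ⟨by simp, ENNReal.sum_lt_top.2 fun i _ => ?_⟩
  rw [lintegral_add_left (by fun_prop)]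
  exact ENNReal.add_lt_top.2 ⟨h _, h _⟩

end ExpMoments

/-! ### Weak limits and the law of the compensated small jumps. -/

/-- The continuity theorem: a pointwise limit of characteristic functions which is continuous at
`0` is the characteristic function of the weak limit. -/
theorem exists_tendsto_of_tendsto_charFun {d : ℕ}
    {μ : ℕ → ProbabilityMeasure (EuclideanSpace ℝ (Fin d))} {f : EuclideanSpace ℝ (Fin d) → ℂ}
    (hf : ContinuousAt f 0)
    (h : ∀ t, Tendsto (fun n => charFun (μ n : Measure (EuclideanSpace ℝ (Fin d))) t) atTop
      (nhds (f t))) :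
    ∃ ν : ProbabilityMeasure (EuclideanSpace ℝ (Fin d)),
      (∀ t, charFun (ν : Measure (EuclideanSpace ℝ (Fin d))) t = f t) ∧
        Tendsto μ atTop (nhds ν) := by
  have htight := isTightMeasureSet_of_tendsto_charFun
    (μ := fun n => (μ n : Measure (EuclideanSpace ℝ (Fin d)))) hf h
  have hcomp : IsCompact (closure {μ n | n}) :=
    isCompact_closure_of_isTightMeasureSet (by simpa [Set.range] using htight)
  -- Tightness gives a limit along an ultrafilter finer than `atTop`. This identifies `f` as a
  -- characteristic function, after which the whole sequence converges.
  obtain ⟨ν, -, hν : Tendsto _ _ _⟩ := hcomp.ultrafilter_le_nhds ((hyperfilter ℕ).map μ)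
    (.trans (by simp) (monotone_principal subset_closure))
  have hcf : ∀ t, charFun (ν : Measure (EuclideanSpace ℝ (Fin d))) t = f t := fun t => by
    have h1 := (ProbabilityMeasure.tendsto_iff_forall_integral_rclike_tendsto ℂ).1 hν
      (BoundedContinuousFunction.innerProbChar t)
    simp_rw [← charFun_eq_integral_innerProbChar] at h1
    exact tendsto_nhds_unique h1 ((h t).mono_left Nat.hyperfilter_le_atTop)
  refine ⟨ν, hcf, ProbabilityMeasure.tendsto_of_tendsto_charFun fun t => ?_⟩
  rw [hcf]
  exact h t

section SmallJumps

variable {d : ℕ}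

/-- The compensated exponent `e^{i⟨x,z⟩} - 1 - i⟨x,z⟩`. -/
noncomputable def compensatedExp (z x : EuclideanSpace ℝ (Fin d)) : ℂ :=
  Complex.exp (Complex.I * (inner ℝ z x : ℝ)) - 1 - Complex.I * (inner ℝ z x : ℝ)

theorem norm_exp_sub_one_sub_le (w : ℂ) : ‖Complex.exp w - 1 - w‖ ≤ ‖w‖ ^ 2 * Real.exp ‖w‖ := by
  simpa [Finset.sum_range_succ, sub_sub] using Complex.norm_exp_sub_sum_le_norm_mul_exp w 2

theorem norm_compensatedExp_le (z : EuclideanSpace ℝ (Fin d)) {x : EuclideanSpace ℝ (Fin d)}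
    (hx : ‖x‖ ≤ 1) : ‖compensatedExp z x‖ ≤ ‖z‖ ^ 2 * Real.exp ‖z‖ * ‖x‖ ^ 2 := by
  have h1 : ‖Complex.I * (inner ℝ z x : ℝ)‖ ≤ ‖z‖ * ‖x‖ := by
    simpa using abs_real_inner_le_norm z x
  calc ‖compensatedExp z x‖ ≤ _ := norm_exp_sub_one_sub_le _
    _ ≤ (‖z‖ * ‖x‖) ^ 2 * Real.exp ‖z‖ := by
      gcongr
      exact h1.trans (mul_le_of_le_one_right (norm_nonneg z) hx)
    _ = _ := by ring

theorem exp_sub_one_sub_inner_le (w : EuclideanSpace ℝ (Fin d)) {x : EuclideanSpace ℝ (Fin d)}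
    (hx : ‖x‖ ≤ 1) :
    Real.exp (inner ℝ w x) - 1 - inner ℝ w x ≤ ‖w‖ ^ 2 * Real.exp ‖w‖ * ‖x‖ ^ 2 := by
  have h1 : |inner ℝ w x| ≤ ‖w‖ * ‖x‖ := abs_real_inner_le_norm w x
  have h2 := norm_exp_sub_one_sub_le ((inner ℝ w x : ℝ) : ℂ)
  rw [← Complex.ofReal_exp, ← Complex.ofReal_one, ← Complex.ofReal_sub, ← Complex.ofReal_sub,
    Complex.norm_real, Complex.norm_real, Real.norm_eq_abs, Real.norm_eq_abs] at h2
  calc _ ≤ _ := le_abs_self _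
    _ ≤ _ := h2
    _ ≤ (‖w‖ * ‖x‖) ^ 2 * Real.exp ‖w‖ := by
      gcongr
      exact h1.trans (mul_le_of_le_one_right (norm_nonneg w) hx)
    _ = _ := by ring

variable {σ : Measure (EuclideanSpace ℝ (Fin d))}

theorem integrable_compensatedExp (h1 : ∀ᵐ x ∂σ, ‖x‖ ≤ 1) (h2 : Integrable (fun x => ‖x‖ ^ 2) σ)
    (z : EuclideanSpace ℝ (Fin d)) : Integrable (compensatedExp z) σ := by
  refine (h2.const_mul (‖z‖ ^ 2 * Real.exp ‖z‖)).mono' ?_ ?_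
  · exact Measurable.aestronglyMeasurable (by unfold compensatedExp; fun_prop)
  · filter_upwards [h1] with x hx using norm_compensatedExp_le z hx

theorem continuousAt_integral_compensatedExp (h1 : ∀ᵐ x ∂σ, ‖x‖ ≤ 1)
    (h2 : Integrable (fun x => ‖x‖ ^ 2) σ) :
    ContinuousAt (fun z => ∫ x, compensatedExp z x ∂σ) 0 := by
  refine continuousAt_of_dominated (bound := fun x => 1 ^ 2 * Real.exp 1 * ‖x‖ ^ 2)
    (.of_forall fun z => (integrable_compensatedExp h1 h2 z).1) ?_ (h2.const_mul _)
    (.of_forall fun x => ?_)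
  · filter_upwards [Metric.closedBall_mem_nhds (0 : EuclideanSpace ℝ (Fin d)) one_pos] with z hz
    filter_upwards [h1] with x hx
    have hz' : ‖z‖ ≤ 1 := by simpa using hz
    refine (norm_compensatedExp_le z hx).trans ?_
    gcongr
  · unfold compensatedExp
    fun_prop

/-- The compound Poisson distribution of `λ`, centered when `λ` has a finite first moment. -/
noncomputable def centeredCompoundPoisson (lam : Measure (EuclideanSpace ℝ (Fin d))) :
    Measure (EuclideanSpace ℝ (Fin d)) :=
  (Measure.dirac (-∫ x, x ∂lam)).conv (compoundPoisson lam)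

instance isProbabilityMeasure_centeredCompoundPoisson
    (lam : Measure (EuclideanSpace ℝ (Fin d))) [IsFiniteMeasure lam] :
    IsProbabilityMeasure (centeredCompoundPoisson lam) := by
  unfold centeredCompoundPoisson
  infer_instance

theorem integrable_id_of_norm_le_one {lam : Measure (EuclideanSpace ℝ (Fin d))}
    [IsFiniteMeasure lam] (h1 : ∀ᵐ x ∂lam, ‖x‖ ≤ 1) :
    Integrable (fun x : EuclideanSpace ℝ (Fin d) => x) lam :=
  Integrable.of_bound (by fun_prop) 1 h1

theorem charFun_centeredCompoundPoisson (lam : Measure (EuclideanSpace ℝ (Fin d)))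
    [IsFiniteMeasure lam] (h1 : ∀ᵐ x ∂lam, ‖x‖ ≤ 1) (z : EuclideanSpace ℝ (Fin d)) :
    charFun (centeredCompoundPoisson lam) z = Complex.exp (∫ x, compensatedExp z x ∂lam) := by
  have hint := integrable_id_of_norm_le_one h1
  have hinner : Integrable (fun x => ((inner ℝ z x : ℝ) : ℂ)) lam := (hint.const_inner z).ofReal
  have hexp : Integrable (fun x => Complex.exp (Complex.I * (inner ℝ z x : ℝ))) lam := by
    refine Integrable.of_bound (by fun_prop) 1 (.of_forall fun x => ?_)
    rw [mul_comm, Complex.norm_exp_ofReal_mul_I]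
  rw [centeredCompoundPoisson, charFun_conv, charFun_dirac, charFun_compoundPoisson,
    ← Complex.exp_add]
  congr 1
  have hsub : Integrable (fun x => Complex.exp (Complex.I * (inner ℝ z x : ℝ)) - 1) lam :=
    hexp.sub (integrable_const 1)
  unfold compensatedExp
  rw [integral_sub hsub (hinner.const_mul _),
    integral_sub hexp (integrable_const _), integral_const_mul, integral_complex_ofReal,
    integral_inner hint, charFun_apply]
  simp_rw [real_inner_comm z, mul_comm Complex.I]
  simp [inner_neg_right]
  ring

/-- Centering leaves `e^{⟨w,x⟩} - 1 - ⟨w,x⟩` in the exponent, which is quadratic in `x` on the unit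
ball. The bound involves `lam` only through its second moment, hence is uniform under truncation
near `0`. -/
theorem lintegral_exp_centeredCompoundPoisson_le {S : ℝ}
    (lam : Measure (EuclideanSpace ℝ (Fin d))) [IsFiniteMeasure lam] (h1 : ∀ᵐ x ∂lam, ‖x‖ ≤ 1)
    (hS : ∫ x, ‖x‖ ^ 2 ∂lam ≤ S) (w : EuclideanSpace ℝ (Fin d)) :
    ∫⁻ x, ENNReal.ofReal (Real.exp (inner ℝ w x)) ∂(centeredCompoundPoisson lam)
      ≤ ENNReal.ofReal (Real.exp (‖w‖ ^ 2 * Real.exp ‖w‖ * S)) := by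
  have hint := integrable_id_of_norm_le_one h1
  have hinner : Integrable (fun x => (inner ℝ w x : ℝ)) lam := hint.const_inner w
  have hexp : Integrable (fun x => Real.exp (inner ℝ w x)) lam := by
    refine Integrable.of_bound (by fun_prop) (Real.exp ‖w‖) ?_
    filter_upwards [h1] with x hx
    rw [Real.norm_eq_abs, Real.abs_exp]
    gcongr
    exact (real_inner_le_norm w x).trans (mul_le_of_le_one_right (norm_nonneg w) hx)
  have hsq : Integrable (fun x => ‖x‖ ^ 2) lam := by
    refine Integrable.of_bound (by fun_prop) 1 ?_
    filter_upwards [h1] with x hx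
    rw [Real.norm_eq_abs, abs_of_nonneg (by positivity)]
    exact pow_le_one₀ (norm_nonneg x) hx
  have hI : ∫⁻ x, ENNReal.ofReal (Real.exp (inner ℝ w x)) ∂lam
      = ENNReal.ofReal (∫ x, Real.exp (inner ℝ w x) ∂lam) :=
    (ofReal_integral_eq_lintegral_ofReal hexp (.of_forall fun x => by positivity)).symm
  have hadd : ∀ x y : EuclideanSpace ℝ (Fin d), ENNReal.ofReal (Real.exp (inner ℝ w (x + y))) =
      ENNReal.ofReal (Real.exp (inner ℝ w x)) * ENNReal.ofReal (Real.exp (inner ℝ w y)) := by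
    intro x y
    rw [inner_add_right, Real.exp_add, ENNReal.ofReal_mul (by positivity)]
  rw [centeredCompoundPoisson, Measure.lintegral_conv (by fun_prop),
    lintegral_dirac' _ (by fun_prop)]
  simp_rw [hadd]
  rw [lintegral_const_mul _ (by fun_prop), lintegral_compoundPoisson_of_mul lam (by fun_prop)
    (by simp) hadd (by rw [hI]; exact ENNReal.ofReal_ne_top), hI,
    ENNReal.toReal_ofReal (integral_nonneg fun x => by positivity),
    ← ENNReal.ofReal_mul (by positivity), ← Real.exp_add, inner_neg_right, ← integral_inner hint]
  have hsub : Integrable (fun x => Real.exp (inner ℝ w x) - 1) lam :=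
    hexp.sub (integrable_const 1)
  gcongr
  calc _ = ∫ x, (Real.exp (inner ℝ w x) - 1 - inner ℝ w x) ∂lam := by
        rw [integral_sub hsub hinner,
          integral_sub hexp (integrable_const _)]
        simp
        ring
    _ ≤ ∫ x, ‖w‖ ^ 2 * Real.exp ‖w‖ * ‖x‖ ^ 2 ∂lam := by
        refine integral_mono_ae (hsub.sub hinner) (hsq.const_mul _) ?_
        filter_upwards [h1] with x hx using exp_sub_one_sub_inner_le w hx
    _ ≤ _ := by
        rw [integral_const_mul]
        gcongr

/-- Existence of the infinitely divisible distribution with Lévy measure `σ` supported in the unit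
ball; it has all exponential moments. -/
theorem exists_charFun_eq_exp_compensatedExp (h0 : σ {0} = 0) (h1 : ∀ᵐ x ∂σ, ‖x‖ ≤ 1)
    (h2 : Integrable (fun x => ‖x‖ ^ 2) σ) :
    ∃ ν : Measure (EuclideanSpace ℝ (Fin d)), IsProbabilityMeasure ν ∧ HasExpMoments ν ∧
      ∀ z, charFun ν z = Complex.exp (∫ x, compensatedExp z x ∂σ) := by
  -- Each `A n` avoids a neighborhood of `0` and has finite mass; their union is everything but `0`,
  -- which is not charged.
  set A : ℕ → Set (EuclideanSpace ℝ (Fin d)) := fun n => {x | 1 / ((n : ℝ) + 1) < ‖x‖} with hA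
  have hAm : ∀ n, MeasurableSet (A n) := fun n => measurableSet_normTail _
  have hAmono : Monotone A := fun m n hmn x (hx : 1 / ((m : ℝ) + 1) < ‖x‖) =>
    lt_of_le_of_lt (Nat.one_div_le_one_div hmn) hx
  have hAU : ⋃ n, A n = {0}ᶜ := by
    ext x
    simp only [Set.mem_iUnion, Set.mem_compl_iff, Set.mem_singleton_iff]
    constructor
    · rintro ⟨n, hn⟩ rfl
      have h3 : 1 / ((n : ℝ) + 1) < 0 := by simpa [hA] using hn
      have h4 : 0 < 1 / ((n : ℝ) + 1) := by positivity
      linarith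
    · intro hx
      exact exists_nat_one_div_lt (norm_pos_iff.2 hx)
  have hAae : σ.restrict (⋃ n, A n) = σ := by
    rw [hAU]
    exact Measure.restrict_eq_self_of_ae_mem (measure_eq_zero_iff_ae_notMem.1 h0)
  have hfin : ∀ n, IsFiniteMeasure (σ.restrict (A n)) := fun n => by
    refine ⟨?_⟩
    rw [Measure.restrict_apply_univ]
    refine (measure_mono fun x (hx : 1 / ((n : ℝ) + 1) < ‖x‖) => ?_).trans_lt
      (h2.measure_norm_ge_lt_top (ε := (1 / ((n : ℝ) + 1)) ^ 2) (by positivity))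
    show (1 / ((n : ℝ) + 1)) ^ 2 ≤ ‖‖x‖ ^ 2‖
    rw [norm_pow, norm_norm]
    gcongr
  have h1n : ∀ n, ∀ᵐ x ∂σ.restrict (A n), ‖x‖ ≤ 1 := fun n => ae_restrict_of_ae h1
  set μ : ℕ → ProbabilityMeasure (EuclideanSpace ℝ (Fin d)) := fun n =>
    ⟨centeredCompoundPoisson (σ.restrict (A n)), inferInstance⟩ with hμ
  obtain ⟨ν, hν, hlim⟩ := exists_tendsto_of_tendsto_charFun (μ := μ)
    (continuousAt_integral_compensatedExp h1 h2).cexp (fun z => by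
      simp only [hμ, ProbabilityMeasure.coe_mk]
      simp_rw [charFun_centeredCompoundPoisson _ (h1n _)]
      refine (Complex.continuous_exp.tendsto _).comp ?_
      have h3 := tendsto_setIntegral_of_monotone (f := compensatedExp z) hAm hAmono
        (integrable_compensatedExp h1 h2 z).integrableOn
      rwa [hAae] at h3)
  refine ⟨ν, inferInstance, hasExpMoments_of_inner fun w => ?_, hν⟩
  -- By portmanteau and a Fatou argument, the uniform Laplace bound passes to the weak limit.
  refine (lintegral_le_liminf_lintegral_of_forall_isOpen_measure_le_liminf_measure
    (μs := fun n => (μ n : Measure (EuclideanSpace ℝ (Fin d)))) (by fun_prop)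
    (fun x => (Real.exp_pos _).le)
    fun G hG => ProbabilityMeasure.le_liminf_measure_open_of_tendsto hlim hG).trans_lt ?_
  refine lt_of_le_of_lt (liminf_le_of_le (by isBoundedDefault) fun b hb => ?_)
    (ENNReal.ofReal_lt_top (r := Real.exp (‖w‖ ^ 2 * Real.exp ‖w‖ * ∫ x, ‖x‖ ^ 2 ∂σ)))
  obtain ⟨n, hn⟩ := hb.exists
  refine hn.trans (lintegral_exp_centeredCompoundPoisson_le _ (h1n n) ?_ w)
  exact setIntegral_le_integral h2 (.of_forall fun x => by positivity)

end SmallJumps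

/-! ### Splitting off the large jumps. -/

section Decomposition

variable {d : ℕ} {η ρ : Measure (EuclideanSpace ℝ (Fin d))}

theorem IsLevyMeasureOf.measure_norm_gt_one_lt_top (h : IsLevyMeasureOf η ρ) :
    η {x | 1 < ‖x‖} < ∞ := by
  calc η {x | 1 < ‖x‖} = ∫⁻ _ in {x | 1 < ‖x‖}, 1 ∂η := by simp
    _ ≤ ∫⁻ x in {x | 1 < ‖x‖}, ENNReal.ofReal (min 1 (‖x‖ ^ 2)) ∂η := by
      refine setLIntegral_mono' (measurableSet_normTail 1) fun x (hx : 1 < ‖x‖) => ?_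
      rw [min_eq_left (one_le_pow₀ hx.le), ENNReal.ofReal_one]
    _ ≤ _ := setLIntegral_le_lintegral _ _
    _ < ∞ := h.2.1

theorem IsLevyMeasureOf.integrable_sq (h : IsLevyMeasureOf η ρ) :
    Integrable (fun x => ‖x‖ ^ 2) (η.restrict {x | ‖x‖ ≤ 1}) := by
  refine ⟨by fun_prop, ?_⟩
  rw [hasFiniteIntegral_iff_ofReal (.of_forall fun x => by positivity)]
  refine lt_of_le_of_lt ?_ h.2.1
  refine le_trans ?_ (setLIntegral_le_lintegral {x | ‖x‖ ≤ 1} _)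
  refine setLIntegral_mono' (measurableSet_le measurable_norm measurable_const)
    fun x (hx : ‖x‖ ≤ 1) => ?_
  rw [min_eq_right (pow_le_one₀ (norm_nonneg x) hx)]

/-- An infinitely divisible distribution is the convolution of a distribution with all exponential
moments and of the compound Poisson distribution of its large jumps. -/
theorem IsLevyMeasureOf.exists_conv_compoundPoisson [IsProbabilityMeasure ρ]
    (h : IsLevyMeasureOf η ρ) :
    ∃ ν : Measure (EuclideanSpace ℝ (Fin d)), IsProbabilityMeasure ν ∧ HasExpMoments ν ∧
      ρ = ν.conv (compoundPoisson (η.restrict {x | 1 < ‖x‖})) := by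
  have hbig := h.measure_norm_gt_one_lt_top
  have hsq := h.integrable_sq
  obtain ⟨h0, -, A, γ, hApos, hcf⟩ := h
  have hB : MeasurableSet {x : EuclideanSpace ℝ (Fin d) | ‖x‖ ≤ 1} :=
    measurableSet_le measurable_norm measurable_const
  have hBc : {x : EuclideanSpace ℝ (Fin d) | 1 < ‖x‖} = {x | ‖x‖ ≤ 1}ᶜ := by
    ext x
    simp
  have h1 : ∀ᵐ x ∂η.restrict {x | ‖x‖ ≤ 1}, ‖x‖ ≤ 1 := ae_restrict_mem hB
  have : IsFiniteMeasure (η.restrict {x | 1 < ‖x‖}) := ⟨by simpa using hbig⟩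
  obtain ⟨ν, hνp, hνm, hν⟩ := exists_charFun_eq_exp_compensatedExp
    (nonpos_iff_eq_zero.1 ((Measure.restrict_apply_le _ _).trans h0.le)) h1 hsq
  -- The Gaussian factor carries the drift `γ` and the matrix `A`, which may be degenerate.
  refine ⟨(ProbabilityTheory.multivariateGaussian γ A).conv ν, inferInstance,
    hasExpMoments_of_isGaussian.conv hνm, Measure.ext_of_charFun (funext fun z => ?_)⟩
  rw [hcf, charFun_conv, charFun_conv, ProbabilityTheory.charFun_multivariateGaussian hApos, hν,
    charFun_compoundPoisson, ← Complex.exp_add, ← Complex.exp_add]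
  congr 1
  have hexp : Integrable (fun x => Complex.exp (Complex.I * (inner ℝ z x : ℝ)))
      (η.restrict {x | 1 < ‖x‖}) := by
    refine Integrable.of_bound (by fun_prop) 1 (.of_forall fun x => ?_)
    rw [mul_comm, Complex.norm_exp_ofReal_mul_I]
  set F : EuclideanSpace ℝ (Fin d) → ℂ := fun x => Complex.exp (Complex.I * (inner ℝ z x : ℝ)) - 1
      - (if ‖x‖ ≤ 1 then Complex.I * (inner ℝ z x : ℝ) else 0) with hF
  have hsmall : ∀ᵐ x ∂η.restrict {x | ‖x‖ ≤ 1}, F x = compensatedExp z x := by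
    filter_upwards [h1] with x hx
    simp [hF, compensatedExp, hx]
  have hlarge : ∀ᵐ x ∂η.restrict {x | 1 < ‖x‖},
      F x = Complex.exp (Complex.I * (inner ℝ z x : ℝ)) - 1 := by
    filter_upwards [ae_restrict_mem (measurableSet_normTail 1)] with x hx
    simp [hF, not_le.2 (show 1 < ‖x‖ from hx)]
  have hFs : IntegrableOn F {x | ‖x‖ ≤ 1} η :=
    (integrable_compensatedExp h1 hsq z).congr (hsmall.mono fun _ h => h.symm)
  have hFl : IntegrableOn F {x | 1 < ‖x‖} η :=
    (hexp.sub (integrable_const _)).congr (hlarge.mono fun _ h => h.symm)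
  have hint : ∫ x, F x ∂η = ∫ x, compensatedExp z x ∂(η.restrict {x | ‖x‖ ≤ 1}) +
      (charFun (η.restrict {x | 1 < ‖x‖}) z - (η.restrict {x | 1 < ‖x‖}).real Set.univ) := by
    have hFi : Integrable F η := by
      rw [← integrableOn_univ, ← Set.union_compl_self {x : EuclideanSpace ℝ (Fin d) | ‖x‖ ≤ 1},
        ← hBc]
      exact hFs.union hFl
    rw [← integral_add_compl hB hFi, ← hBc, integral_congr_ae hsmall, integral_congr_ae hlarge,
      integral_sub hexp (integrable_const _), charFun_apply]
    simp_rw [real_inner_comm z, mul_comm Complex.I]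
    simp
  rw [levyExponent, hint, dotProduct_comm, real_inner_comm]
  ring

end Decomposition

/-! ### Integrals of increasing functions of the norm. -/

section MonotoneIntegral

variable {d : ℕ} {μ ν : Measure (EuclideanSpace ℝ (Fin d))}

theorem tendsto_normTail_sub (μ : Measure (EuclideanSpace ℝ (Fin d))) [IsFiniteMeasure μ] (s : ℝ) :
    Tendsto (fun n : ℕ => normTail μ (s - 1 / ((n : ℝ) + 1))) atTop (nhds (μ {x | s ≤ ‖x‖})) := by
  have h : {x : EuclideanSpace ℝ (Fin d) | s ≤ ‖x‖}
      = ⋂ n : ℕ, {x | s - 1 / ((n : ℝ) + 1) < ‖x‖} := by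
    ext x
    simp only [Set.mem_ofPred_eq, Set.mem_iInter]
    constructor
    · intro hx n
      have : 0 < 1 / ((n : ℝ) + 1) := by positivity
      linarith
    · intro hx
      by_contra! hlt
      obtain ⟨n, hn⟩ := exists_nat_one_div_lt (sub_pos.2 hlt)
      linarith [hx n]
  rw [h]
  refine tendsto_measure_iInter_atTop (fun n => (measurableSet_normTail _).nullMeasurableSet) ?_
    ⟨0, measure_ne_top _ _⟩
  intro m n hmn x (hx : s - 1 / ((n : ℝ) + 1) < ‖x‖)
  show s - 1 / ((m : ℝ) + 1) < ‖x‖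
  have := Nat.one_div_le_one_div (α := ℝ) hmn
  linarith

/-- A nonempty upper set is an open or closed ray. Open rays are the hypothesis; closed ones follow
by letting the threshold increase to the endpoint. -/
theorem measure_norm_preimage_le_of_isUpperSet [IsFiniteMeasure μ] [IsFiniteMeasure ν] {K : ℝ≥0}
    (hK : ∀ r, normTail μ r ≤ K * normTail ν r) {U : Set ℝ≥0} (hU : IsUpperSet U) :
    μ {x | ‖x‖₊ ∈ U} ≤ K * ν {x | ‖x‖₊ ∈ U} := by
  rcases U.eq_empty_or_nonempty with rfl | hne
  · simp
  by_cases hs : sInf U ∈ U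
  · have h1 : {x : EuclideanSpace ℝ (Fin d) | ‖x‖₊ ∈ U} = {x | ((sInf U : ℝ≥0) : ℝ) ≤ ‖x‖} := by
      ext x
      exact ⟨fun hx => (NNReal.coe_le_coe.2 (csInf_le' hx) :), fun hx => hU (a := sInf U) hx hs⟩
    rw [h1]
    exact le_of_tendsto_of_tendsto' (tendsto_normTail_sub μ _)
      (ENNReal.Tendsto.const_mul (tendsto_normTail_sub ν _) (Or.inr ENNReal.coe_ne_top))
      fun n => hK _
  · have h1 : {x : EuclideanSpace ℝ (Fin d) | ‖x‖₊ ∈ U} = {x | ((sInf U : ℝ≥0) : ℝ) < ‖x‖} := by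
      ext x
      constructor
      · intro hx
        have h2 : sInf U < ‖x‖₊ :=
          lt_of_le_of_ne (csInf_le' hx) fun h => hs (h ▸ hx)
        exact h2
      · intro (hx : sInf U < ‖x‖₊)
        obtain ⟨u, hu, hux⟩ := (csInf_lt_iff (OrderBot.bddBelow U) hne).1 hx
        exact hU hux.le hu
    rw [h1]
    exact hK _

/-- Layer-cake formula: superlevel sets of a monotone function are upper sets. -/
theorem lintegral_norm_le_of_normTail_le [IsFiniteMeasure μ] [IsFiniteMeasure ν] {K : ℝ≥0}
    (hK : ∀ r, normTail μ r ≤ K * normTail ν r) {h : ℝ≥0 → ℝ≥0} (hh : Monotone h) :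
    ∫⁻ x, (h ‖x‖₊ : ℝ≥0∞) ∂μ ≤ K * ∫⁻ x, (h ‖x‖₊ : ℝ≥0∞) ∂ν := by
  have hm : Measurable fun x : EuclideanSpace ℝ (Fin d) => (h ‖x‖₊ : ℝ) :=
    (hh.measurable.comp measurable_nnnorm).coe_nnreal_real
  have hcake : ∀ m : Measure (EuclideanSpace ℝ (Fin d)), ∫⁻ x, (h ‖x‖₊ : ℝ≥0∞) ∂m
      = ∫⁻ t in Set.Ioi 0, m {x | t < (h ‖x‖₊ : ℝ)} := fun m => by
    rw [← lintegral_eq_lintegral_meas_lt m (.of_forall fun x => NNReal.coe_nonneg _)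
      hm.aemeasurable]
    simp
  rw [hcake, hcake, ← lintegral_const_mul' _ _ ENNReal.coe_ne_top]
  refine lintegral_mono fun t => ?_
  exact measure_norm_preimage_le_of_isUpperSet hK (U := {y | t < (h y : ℝ)})
    fun a b hab (ha : t < (h a : ℝ)) => ha.trans_le (NNReal.coe_le_coe.2 (hh hab))

theorem TailLE.lintegral_norm_lt_top [IsFiniteMeasure μ] [IsFiniteMeasure ν]
    (hle : TailLE (normTail μ) (normTail ν)) {h : ℝ≥0 → ℝ≥0} (hh : Monotone h)
    (hν : ∫⁻ x, (h ‖x‖₊ : ℝ≥0∞) ∂ν < ∞) : ∫⁻ x, (h ‖x‖₊ : ℝ≥0∞) ∂μ < ∞ := by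
  obtain ⟨K, hK⟩ := hle
  exact (lintegral_norm_le_of_normTail_le hK hh).trans_lt (ENNReal.mul_lt_top (by simp) hν)

end MonotoneIntegral

/-! ### Transfer of OS, and the theorem. -/

section TailEquivalence

variable {d : ℕ} {μ ν : Measure (EuclideanSpace ℝ (Fin d))}
  [IsProbabilityMeasure μ] [IsProbabilityMeasure ν] {c : ℝ≥0}

theorem IsOSubexp.conv_compoundPoisson {n : ℕ} (h : IsOSubexp (convPower μ n)) (hn : 0 < n)
    (hν : HasExpMoments ν) (hc : c ≠ 0) :
    IsOSubexp (ν.conv (compoundPoisson (c • μ))) ∧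
      TailLE (normTail (convPower μ n)) (normTail (ν.conv (compoundPoisson (c • μ)))) ∧
      TailLE (normTail (ν.conv (compoundPoisson (c • μ)))) (normTail (convPower μ n)) := by
  have h1 := tailLE_compoundPoisson (μ := μ) hc n
  have h2 := h.compoundPoisson_tailLE hn c
  have hCP := h.congr h1 h2
  have h3 := hCP.tailLE_conv (μ := ν)
  have h4 := hCP.tailLE_conv_right hν
  exact ⟨hCP.congr h3 h4, h1.trans h3, h4.trans h2⟩

theorem IsOSubexp.exists_isOSubexp_convPower
    (h : IsOSubexp (ν.conv (compoundPoisson (c • μ)))) (hν : HasExpMoments ν) (hc : c ≠ 0) :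
    ∃ n, 0 < n ∧ IsOSubexp (convPower μ n) := by
  have hCP := h.congr (h.tailLE_of_conv hν) h.tailLE_conv_of_conv
  obtain ⟨N, hN, hle⟩ := hCP.exists_tailLE_convPower
  exact ⟨N, hN, hCP.congr hle (tailLE_compoundPoisson hc N)⟩

theorem asympEquiv_normTail (h : IsOSubexp μ) (h1 : TailLE (normTail μ) (normTail ν))
    (h2 : TailLE (normTail ν) (normTail μ)) : AsympEquiv (normTail μ) (normTail ν) :=
  (asympEquiv_iff normTail_le_one normTail_le_one (normTail_antitone _) (normTail_antitone _)).2
    ⟨(isOSubexp_iff.1 h).1, h1, h2⟩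

end TailEquivalence

section NormalizedTail

variable {d : ℕ} {η : Measure (EuclideanSpace ℝ (Fin d))}

theorem isProbabilityMeasure_normalizedTail (h0 : η {x | 1 < ‖x‖} ≠ 0)
    (ht : η {x | 1 < ‖x‖} ≠ ∞) : IsProbabilityMeasure (normalizedTail η) :=
  ⟨by simp [normalizedTail, ENNReal.inv_mul_cancel h0 ht]⟩

theorem restrict_eq_smul_normalizedTail (h0 : η {x | 1 < ‖x‖} ≠ 0) (ht : η {x | 1 < ‖x‖} ≠ ∞) :
    η.restrict {x | 1 < ‖x‖} = (η {x | 1 < ‖x‖}).toNNReal • normalizedTail η := by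
  rw [ENNReal.smul_def, ENNReal.coe_toNNReal ht, normalizedTail, smul_smul,
    ENNReal.mul_inv_cancel h0 ht, one_smul]

theorem normTail_eq_mul_normalizedTail (h0 : η {x | 1 < ‖x‖} ≠ 0) (ht : η {x | 1 < ‖x‖} ≠ ∞)
    {r : ℝ} (hr : 1 ≤ r) : normTail η r = η {x | 1 < ‖x‖} * normTail (normalizedTail η) r := by
  have hsub : {x : EuclideanSpace ℝ (Fin d) | r < ‖x‖} ⊆ {x | 1 < ‖x‖} := fun x hx => hr.trans_lt hx
  rw [normTail, normTail, normalizedTail, Measure.smul_apply, smul_eq_mul, ← mul_assoc,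
    ENNReal.mul_inv_cancel h0 ht, one_mul, Measure.restrict_apply (measurableSet_normTail r),
    Set.inter_eq_left.2 hsub]

end NormalizedTail

theorem theorem3p1 (d : ℕ) (ρ η : Measure (EuclideanSpace ℝ (Fin d)))
    [IsProbabilityMeasure ρ] (hρ : IsInfinitelyDivisible ρ) (hη : IsLevyMeasureOf η ρ)
    (hpos : 0 < η {x | 1 < ‖x‖}) :
    -- (i)
    ((IsOSubexp ρ ↔ ∃ n : ℕ, 0 < n ∧ IsOSubexp (convPower (normalizedTail η) n)) ∧
      (IsOSubexp ρ → ∀ n : ℕ, 0 < n → IsOSubexp (convPower (normalizedTail η) n) →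
        AsympEquiv (normTail ρ) (normTail (convPower (normalizedTail η) n)))) ∧
    -- (ii)
    (IsOSubexp (normalizedTail η) → AsympEquiv (normTail ρ) (normTail η)) ∧
    -- (iii)
    (IsOSubexp ρ ↔ ∃ m : ℕ, 0 < m ∧
      IsOSubexpHalfLine (convPower (radialLaw (normalizedTail η)) m) ∧
      AsympEquiv (normTail ρ) (rightTail (convPower (radialLaw (normalizedTail η)) m))) ∧
    -- (iv)
    (IsOSubexp (normalizedTail η) → ∀ h : ℝ≥0 → ℝ≥0, Monotone h →
      ((∫⁻ x, (h ‖x‖₊ : ℝ≥0∞) ∂ρ) < ∞ ↔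
        (∫⁻ x in {x | 1 < ‖x‖}, (h ‖x‖₊ : ℝ≥0∞) ∂η) < ∞)) := by
  have h0 : η {x | 1 < ‖x‖} ≠ 0 := hpos.ne'
  have ht : η {x | 1 < ‖x‖} ≠ ∞ := hη.measure_norm_gt_one_lt_top.ne
  obtain ⟨ν, hνp, hν, hdecomp⟩ := hη.exists_conv_compoundPoisson
  have hprob := isProbabilityMeasure_normalizedTail h0 ht
  have hc : (η {x | 1 < ‖x‖}).toNNReal ≠ 0 := ENNReal.toNNReal_ne_zero.2 ⟨h0, ht⟩
  rw [restrict_eq_smul_normalizedTail h0 ht] at hdecomp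
  have hfwd : ∀ n, 0 < n → IsOSubexp (convPower (normalizedTail η) n) → IsOSubexp ρ ∧
      TailLE (normTail (convPower (normalizedTail η) n)) (normTail ρ) ∧
      TailLE (normTail ρ) (normTail (convPower (normalizedTail η) n)) := fun n hn h => by
    rw [hdecomp]
    exact h.conv_compoundPoisson hn hν hc
  have hbwd : IsOSubexp ρ → ∃ n, 0 < n ∧ IsOSubexp (convPower (normalizedTail η) n) := fun h => by
    rw [hdecomp] at h
    exact h.exists_isOSubexp_convPower hν hc
  have hone : IsOSubexp (normalizedTail η) → IsOSubexp ρ ∧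
      TailLE (normTail (normalizedTail η)) (normTail ρ) ∧
      TailLE (normTail ρ) (normTail (normalizedTail η)) := fun h => by
    have := hfwd 1 one_pos
    rw [convPower_one] at this
    exact this h
  refine ⟨⟨⟨hbwd, fun ⟨n, hn, h⟩ => (hfwd n hn h).1⟩, fun h n hn hS => ?_⟩, fun h => ?_,
    ⟨fun h => ?_, ?_⟩, fun h g hg => ?_⟩
  · obtain ⟨-, h1, h2⟩ := hfwd n hn hS
    exact asympEquiv_normTail h h2 h1
  · obtain ⟨hOS, ⟨K, hK⟩, ⟨L, hL⟩⟩ := hone h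
    -- Below `1` the tail of `η` may differ from this multiple and even be infinite, so the
    -- comparison is only eventual.
    have hη_eq : ∀ᶠ r in atTop, normTail η r = η {x | 1 < ‖x‖} * normTail (normalizedTail η) r :=
      (eventually_ge_atTop 1).mono fun r hr => normTail_eq_mul_normalizedTail h0 ht hr
    refine asympEquiv_of_eventually (K := (η {x | 1 < ‖x‖})⁻¹ * L) (L := η {x | 1 < ‖x‖} * K)
      (ENNReal.mul_ne_top (ENNReal.inv_ne_top.2 h0) ENNReal.coe_ne_top)
      (ENNReal.mul_ne_top ht ENNReal.coe_ne_top) ?_ ?_ ?_ ?_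
    · filter_upwards [hη_eq] with r hr
      rw [hr]
      exact ENNReal.mul_pos h0 ((isOSubexp_iff.1 h).1 r).ne'
    · filter_upwards [hη_eq] with r hr
      rw [hr]
      exact ENNReal.mul_ne_top ht ((normTail_le_one r).trans_lt ENNReal.one_lt_top).ne
    · filter_upwards [hη_eq] with r hr
      rw [hr, mul_right_comm, ← mul_assoc, ENNReal.inv_mul_cancel h0 ht, one_mul, mul_comm]
      exact hL r
    · filter_upwards [hη_eq] with r hr
      rw [hr, mul_assoc]
      gcongr
      exact hK r
  · obtain ⟨n, hn, hS⟩ := hbwd h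
    obtain ⟨-, h1, h2⟩ := hfwd n hn hS
    -- The same `n` serves as `m`: Kesten's bound controls the power of the radial law from above,
    -- the triangle inequality from below.
    obtain ⟨C, hC⟩ := hS.exists_rightTail_convPower_le hn
    have h3 : TailLE (rightTail (convPower (radialLaw (normalizedTail η)) n))
        (rightTail (radialLaw ρ)) := by
      rw [← normTail_eq_rightTail]
      exact TailLE.trans ⟨C ^ n, hC n⟩ h1
    have h4 : TailLE (rightTail (radialLaw ρ))
        (rightTail (convPower (radialLaw (normalizedTail η)) n)) := by
      rw [← normTail_eq_rightTail]
      exact h2.trans (.of_le (normTail_convPower_le n))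
    refine ⟨n, hn, IsOSubexpHalfLine.congr h h4 h3, ?_⟩
    rw [normTail_eq_rightTail]
    exact (asympEquiv_iff rightTail_le_one rightTail_le_one (rightTail_antitone _)
      (rightTail_antitone _)).2 ⟨(isOSubexpHalfLine_iff.1 h).1, h4, h3⟩
  · rintro ⟨m, -, hm, hequiv⟩
    rw [normTail_eq_rightTail] at hequiv
    obtain ⟨-, h1, h2⟩ := (asympEquiv_iff rightTail_le_one rightTail_le_one (rightTail_antitone _)
      (rightTail_antitone _)).1 hequiv
    exact IsOSubexpHalfLine.congr hm h2 h1
  · obtain ⟨-, h1, h2⟩ := hone h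
    rw [restrict_eq_smul_normalizedTail h0 ht, ENNReal.smul_def, lintegral_smul_measure,
      smul_eq_mul]
    have h3 : ((η {x | 1 < ‖x‖}).toNNReal : ℝ≥0∞) ≠ 0 := by exact_mod_cast hc
    refine ⟨fun hfin => ENNReal.mul_lt_top (by simp) (h1.lintegral_norm_lt_top hg hfin),
      fun hfin => h2.lintegral_norm_lt_top hg ?_⟩
    exact ENNReal.lt_top_of_mul_ne_top_right hfin.ne h3
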